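/- Let $\mathcal V$ be a complex superspace with $N$ even and $M$ odd coordinates, $[a]\in\mathbb Z/2$ the degree of the index $a$, and let $\epsilon=\pm1$. Let $\varepsilon_{ab}\in\mathbb C$ be an invertible even super-metric: $\varepsilon_{ab}=0$ if $[a]\ne[b]$, and $\varepsilon_{ab}=\epsilon(-1)^{[a][b]}\varepsilon_{ba}$. Let $\varepsilon^{ab}$ be the inverse matrix and $\omega=\epsilon(N-M)$. Repeated indices are summed. Let $\mathcal A$ be the associative unital $\mathbb C$-algebra generated by the super-oscillators $c^a$ (of degree $[a]$) with $c^ac^b+\epsilon(-1)^{[a][b]}c^bc^a=\varepsilon^{ab}$. Let $c^{(a_1}\cdots c^{a_k)}=\frac1{k!}\sum_{\sigma\in S_k}s_\sigma\,c^{a_{\sigma(1)}}\cdots c^{a_{\sigma(k)}}$, where $s_\sigma$ is the product of $-\epsilon(-1)^{[a_{\sigma(i)}][a_{\sigma(j)}]}$ over all $i<j$ with $\sigma(i)>\sigma(j)$, and put $F^{ab}=\epsilon(-1)^{[b]}c^{(a}c^{b)}$. Let $\mathcal H$ be the algebra generated by $x_a,\partial_a$ (of degree $[a]$) with $$x_ax_b=\epsilon(-1)^{[a][b]}x_bx_a,\quad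 \partial_a\partial_b=\epsilon(-1)^{[a][b]}\partial_b\partial_a,\quad \partial_ax_b-\epsilon(-1)^{[a][b]}x_b\partial_a=\varepsilon_{ab},$$ and let $M_{ab}=x_a\partial_b-\epsilon(-1)^{[a][b]+[a]+[b]}x_b\partial_a\in\mathcal H$, of degree $[a]+[b]$ (the Jordan–Schwinger generators of $osp$). **(i)** For all indices $a,b,c,d$ one has $\{M_{(bc},M_{d)a}\}_\mp=0$. Here $\{X,Y\}_\mp=XY+(-1)^{[X][Y]}YX$, and $(bcd)$ denotes the supersymmetrization over $b,c,d$ as above, but with the factor $-\epsilon(-1)^{[s][t]+[s]+[t]}$ for the exchange of the indices $s,t$. **(ii)** In the graded tensor product $\mathcal A\otimes\mathcal A\otimes\mathcal H$ let $c_1^a,c_2^a$ denote the generators of the first and second factor, let $F_1^{ab},F_2^{ab}$ be the corresponding copies of $F^{ab}$, and let $L_j(u)=u\,I-\frac12F_j^{ab}M_{ba}$ for $j=1,2$, where $I$ is the unit element. Consider the formal series $$\check{\mathcal R}_{12}(u)=\sum_{k\ge0}\frac{r_k(u)}{k!}\,\varepsilon_{a_1b_1}\cdots\varepsilon_{a_kb_k}\,c_1^{(a_1}\cdots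 c_1^{a_k)}\,c_2^{(b_k}\cdots c_2^{b_1)} .$$ Then for all $u,v\in\mathbb C$ $$\check{\mathcal R}_{12}(u)L_1(u+v)L_2(v)=L_1(v)L_2(u+v)\check{\mathcal R}_{12}(u)$$ whenever the numbers $r_k(u)$ satisfy $(k+2+u-\omega)\,r_{k+2}(u)=4(u-k)\,r_k(u)$ for all $k\ge0$. In particular, this relation holds for all $u\in\mathbb C\setminus\{0,1,2,\dots\}$, all $v\in\mathbb C$ and arbitrary functions $A,B:\mathbb C\to\mathbb C$, if for all $m\ge0$ $$r_{2m}(u)=(-4)^m\frac{\Gamma(m-\frac u2)}{\Gamma(m+1+\frac{u-\omega}2)}A(u),\qquad r_{2m+1}(u)=(-4)^m\frac{\Gamma(m-\frac{u-1}2)}{\Gamma(m+1+\frac{u-\omega+1}2)}B(u),$$ where $1/\Gamma$ is zero at the poles of $\Gamma$. The products with the formal series are taken termwise, and the equality means equality of all coefficients with respect to the supersymmetrized monomials in $c_1$ and in $c_2$: for every $n$, the difference of the two sides for the $K$-th partial sum lies, for all large $K$, in the span of the elements $c_1^{(a_1}\cdots c_1^{a_k)}c_2^{(b_1}\cdots c_2^{b_l)}h$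 with $k+l\ge n$ and $h\in\mathcal H$. -/

import Mathlib

noncomputable section

/-- The sign `(-1)^x` of a degree `x ∈ ℤ/2`. -/
def sgn (x : ZMod 2) : ℂ := if x = 0 then 1 else -1

/-- A superspace with coordinates indexed by `ι`, the coordinate `a` having degree `deg a`,
endowed with an even non-degenerate super-metric `ε_{ab} = g a b` of symmetry type
`ϵ = eps = ± 1`. -/
structure SuperMetric (ι : Type*) [Fintype ι] [DecidableEq ι] where
  deg : ι → ZMod 2
  eps : ℂ
  g : Matrix ι ι ℂ
  eps_eq : eps = 1 ∨ eps = -1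
  symm : ∀ a b, g a b = eps * sgn (deg a * deg b) * g b a
  even : ∀ a b, g a b ≠ 0 → deg a + deg b = 0
  nondeg : IsUnit g.det

/-- The sign acquired by a word `a_0 … a_{k-1}` when it is rearranged to
`a_{σ 0} … a_{σ (k-1)}`, if the exchange of two adjacent letters `s, t` costs the factor `w s t`:
the product of the factors of all inverted pairs. -/
def wordSign {ι : Type*} (w : ι → ι → ℂ) {k : ℕ} (σ : Equiv.Perm (Fin k)) (a : Fin k → ι) : ℂ :=
  ∏ i : Fin k, ∏ j : Fin k, if i < j ∧ σ j < σ i then w (a (σ i)) (a (σ j)) else 1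

/-- Super-symmetrization of a function of `k` indices with exchange factors `w`. -/
def superSym {ι : Type*} (w : ι → ι → ℂ) {V : Type*} [AddCommGroup V] [Module ℂ V] {k : ℕ}
    (f : (Fin k → ι) → V) (a : Fin k → ι) : V :=
  ((k.factorial : ℂ)⁻¹) • ∑ σ : Equiv.Perm (Fin k), wordSign w σ a • f (fun i => a (σ i))

/-- The super-anticommutator `XY + (-1)^{xy} YX` of elements `X`, `Y` of degrees `x`, `y`. -/
def superAnti {B : Type*} [Ring B] [Algebra ℂ B] (x y : ZMod 2) (X Y : B) : B :=
  X * Y + sgn (x * y) • (Y * X)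

namespace SuperMetric

variable {ι : Type*} [Fintype ι] [DecidableEq ι] (S : SuperMetric ι)

/-- `ω = ϵ (N - M)`, with `N` even and `M` odd coordinates. -/
def omega : ℂ :=
  S.eps * (((Finset.univ.filter fun a => S.deg a = 0).card : ℂ)
    - ((Finset.univ.filter fun a => S.deg a = 1).card : ℂ))

/-- The sign `ϵ (-1)^{[a][b]}`. -/
def exch (a b : ι) : ℂ := S.eps * sgn (S.deg a * S.deg b)

/-! ### The super-oscillator algebra -/

/-- `c^a c^b + ϵ (-1)^{[a][b]} c^b c^a = ε^{ab}`, where `ε^{ab}` is the matrix inverse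
to `ε_{ab}`. -/
inductive OscRel : FreeAlgebra ℂ ι → FreeAlgebra ℂ ι → Prop
  | rel (a b : ι) : OscRel
      (FreeAlgebra.ι ℂ a * FreeAlgebra.ι ℂ b
        + S.exch a b • (FreeAlgebra.ι ℂ b * FreeAlgebra.ι ℂ a))
      (algebraMap ℂ (FreeAlgebra ℂ ι) (S.g⁻¹ a b))

/-- The algebra `𝒜` of super-oscillators. -/
abbrev Osc := RingQuot S.OscRel

/-- The super-oscillator `c^a`, of degree `[a]`. -/
def c (a : ι) : S.Osc := RingQuot.mkAlgHom ℂ S.OscRel (FreeAlgebra.ι ℂ a)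

/-- The super-symmetrized product `c^{(a_1} ⋯ c^{a_k)}`, whose elementary transpositions
carry the factors `-ϵ (-1)^{[a][b]}`. -/
def symProd {k : ℕ} (a : Fin k → ι) : S.Osc :=
  superSym (fun s t => -S.exch s t) (fun b : Fin k → ι => (List.ofFn fun i => S.c (b i)).prod) a

/-- `F^{ab} = ϵ (-1)^{[b]} c^{(a} c^{b)}`. -/
def F (a b : ι) : S.Osc := (S.eps * sgn (S.deg b)) • S.symProd ![a, b]

/-! ### The graded Heisenberg algebra and the Jordan-Schwinger generators -/

/-- Relations of the graded canonical pairs; `Sum.inl a` stands for `x_a` and `Sum.inr a`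
for `∂_a`. -/
inductive HeisRel : FreeAlgebra ℂ (ι ⊕ ι) → FreeAlgebra ℂ (ι ⊕ ι) → Prop
  | xx (a b : ι) : HeisRel
      (FreeAlgebra.ι ℂ (Sum.inl a) * FreeAlgebra.ι ℂ (Sum.inl b))
      (S.exch a b • (FreeAlgebra.ι ℂ (Sum.inl b) * FreeAlgebra.ι ℂ (Sum.inl a)))
  | dd (a b : ι) : HeisRel
      (FreeAlgebra.ι ℂ (Sum.inr a) * FreeAlgebra.ι ℂ (Sum.inr b))
      (S.exch a b • (FreeAlgebra.ι ℂ (Sum.inr b) * FreeAlgebra.ι ℂ (Sum.inr a)))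
  | dx (a b : ι) : HeisRel
      (FreeAlgebra.ι ℂ (Sum.inr a) * FreeAlgebra.ι ℂ (Sum.inl b)
        - S.exch a b • (FreeAlgebra.ι ℂ (Sum.inl b) * FreeAlgebra.ι ℂ (Sum.inr a)))
      (algebraMap ℂ (FreeAlgebra ℂ (ι ⊕ ι)) (S.g a b))

/-- The graded Heisenberg algebra `ℋ`. -/
abbrev Heis := RingQuot S.HeisRel

/-- The variable `x_a`, of degree `[a]`. -/
def x (a : ι) : S.Heis := RingQuot.mkAlgHom ℂ S.HeisRel (FreeAlgebra.ι ℂ (Sum.inl a))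

/-- The derivative `∂_a`, of degree `[a]`. -/
def d (a : ι) : S.Heis := RingQuot.mkAlgHom ℂ S.HeisRel (FreeAlgebra.ι ℂ (Sum.inr a))

/-- The sign `ϵ (-1)^{[a][b] + [a] + [b]}`. -/
def exchM (a b : ι) : ℂ := S.eps * sgn (S.deg a * S.deg b + S.deg a + S.deg b)

/-- `M_{ab} = x_a ∂_b - ϵ (-1)^{[a][b] + [a] + [b]} x_b ∂_a`, of degree `[a] + [b]`. -/
def M (a b : ι) : S.Heis := S.x a * S.d b - S.exchM a b • (S.x b * S.d a)

/-- `{M_{(bc}, M_{d)a}}_∓`: the super-anticommutator of `M_{bc}` and `M_{da}`, super-symmetrized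
over `b, c, d` with the factors `-ϵ (-1)^{[s][t] + [s] + [t]}` for elementary transpositions. -/
def symAntiM (b c d a : ι) : S.Heis :=
  superSym (fun s t => -S.exchM s t)
    (fun t : Fin 3 → ι =>
      superAnti (S.deg (t 0) + S.deg (t 1)) (S.deg (t 2) + S.deg a)
        (S.M (t 0) (t 1)) (S.M (t 2) a))
    ![b, c, d]

/-! ### The graded tensor product `𝒜 ⊗ 𝒜 ⊗ ℋ` -/

/-- Generators of the graded tensor product: `Sum.inl (j, a)` is `c^a` of the `j`-th factor `𝒜`,
and `Sum.inr` gives the generators of `ℋ`. -/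
abbrev Gen (ι : Type*) := (Fin 2 × ι) ⊕ (ι ⊕ ι)

/-- Degree of a generator of `ℋ`. -/
def degH (y : ι ⊕ ι) : ZMod 2 := Sum.elim S.deg S.deg y

/-- The graded tensor product `𝒜 ⊗ 𝒜 ⊗ ℋ` by generators and relations: each factor keeps its
relations, and generators `X`, `Y` of different factors satisfy `X Y = (-1)^{[X][Y]} Y X`. -/
inductive TensorRel : FreeAlgebra ℂ (Gen ι) → FreeAlgebra ℂ (Gen ι) → Prop
  | osc (j : Fin 2) {s t : FreeAlgebra ℂ ι} (h : S.OscRel s t) : TensorRel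
      (FreeAlgebra.lift ℂ (fun a => FreeAlgebra.ι ℂ (Sum.inl (j, a) : Gen ι)) s)
      (FreeAlgebra.lift ℂ (fun a => FreeAlgebra.ι ℂ (Sum.inl (j, a) : Gen ι)) t)
  | heis {s t : FreeAlgebra ℂ (ι ⊕ ι)} (h : S.HeisRel s t) : TensorRel
      (FreeAlgebra.lift ℂ (fun y => FreeAlgebra.ι ℂ (Sum.inr y : Gen ι)) s)
      (FreeAlgebra.lift ℂ (fun y => FreeAlgebra.ι ℂ (Sum.inr y : Gen ι)) t)
  | cross_osc (a b : ι) : TensorRel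
      (FreeAlgebra.ι ℂ (Sum.inl (0, a)) * FreeAlgebra.ι ℂ (Sum.inl (1, b)))
      (sgn (S.deg a * S.deg b) •
        (FreeAlgebra.ι ℂ (Sum.inl (1, b)) * FreeAlgebra.ι ℂ (Sum.inl (0, a))))
  | cross_heis (j : Fin 2) (a : ι) (y : ι ⊕ ι) : TensorRel
      (FreeAlgebra.ι ℂ (Sum.inl (j, a)) * FreeAlgebra.ι ℂ (Sum.inr y))
      (sgn (S.deg a * S.degH y) •
        (FreeAlgebra.ι ℂ (Sum.inr y) * FreeAlgebra.ι ℂ (Sum.inl (j, a))))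

/-- The graded tensor product `𝒜 ⊗ 𝒜 ⊗ ℋ`. -/
abbrev Tensor := RingQuot S.TensorRel

/-- The embedding of `𝒜` as the first (`j = 0`) or second (`j = 1`) factor. -/
def inOsc (j : Fin 2) : S.Osc →ₐ[ℂ] S.Tensor :=
  RingQuot.liftAlgHom ℂ
    ⟨(RingQuot.mkAlgHom ℂ S.TensorRel).comp
      (FreeAlgebra.lift ℂ fun a => FreeAlgebra.ι ℂ (Sum.inl (j, a) : Gen ι)),
      fun _ _ h => RingQuot.mkAlgHom_rel ℂ (TensorRel.osc j h)⟩

/-- The embedding of `ℋ` as the third factor. -/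
def inHeis : S.Heis →ₐ[ℂ] S.Tensor :=
  RingQuot.liftAlgHom ℂ
    ⟨(RingQuot.mkAlgHom ℂ S.TensorRel).comp
      (FreeAlgebra.lift ℂ fun y => FreeAlgebra.ι ℂ (Sum.inr y : Gen ι)),
      fun _ _ h => RingQuot.mkAlgHom_rel ℂ (TensorRel.heis h)⟩

/-- The L-operator `L(u) = u I - ½ F^{ab} M_{ba}`, with `F^{ab}` in the `j`-th factor `𝒜`: for
`j = 0, 1` these are `L_1(u)` and `L_2(u)`. -/
def L (j : Fin 2) (u : ℂ) : S.Tensor :=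
  u • (1 : S.Tensor) - (1 / 2 : ℂ) • ∑ a : ι, ∑ b : ι, S.inOsc j (S.F a b) * S.inHeis (S.M b a)

/-! ### The super-spinorial R-operator -/

/-- The invariant
`ε_{a_1 b_1} ⋯ ε_{a_k b_k} c_1^{(a_1} ⋯ c_1^{a_k)} c_2^{(b_k} ⋯ c_2^{b_1)}`. -/
def invariant (k : ℕ) : S.Tensor :=
  ∑ a : Fin k → ι, ∑ b : Fin k → ι,
    (∏ i, S.g (a i) (b i)) •
      (S.inOsc 0 (S.symProd a) * S.inOsc 1 (S.symProd fun i => b i.rev))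

/-- The partial sum over `k < K` of the formal series
`R = ∑_k (r_k / k!) ε_{a_1 b_1} ⋯ ε_{a_k b_k} c_1^{(a_1} ⋯ c_1^{a_k)} c_2^{(b_k} ⋯ c_2^{b_1)}`. -/
def RPartial (r : ℕ → ℂ) (K : ℕ) : S.Tensor :=
  ∑ k ∈ Finset.range K, (r k / (k.factorial : ℂ)) • S.invariant k

/-- The subspace of `𝒜 ⊗ 𝒜 ⊗ ℋ` spanned by the elements
`c_1^{(a_1} ⋯ c_1^{a_k)} c_2^{(b_1} ⋯ c_2^{b_l)} h` with `k + l ≥ n` and `h ∈ ℋ`. Since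
super-symmetrized monomials form a basis of `𝒜`, these subspaces are the neighbourhoods of zero
for convergence of formal series in super-symmetrized monomials. -/
def highDegree (n : ℕ) : Submodule ℂ S.Tensor :=
  Submodule.span ℂ {t | ∃ (k l : ℕ) (a : Fin k → ι) (b : Fin l → ι) (h : S.Heis), n ≤ k + l ∧
    t = S.inOsc 0 (S.symProd a) * S.inOsc 1 (S.symProd b) * S.inHeis h}

/-- The spinorial RLL-relation `R(u) L_1(u+v) L_2(v) = L_1(v) L_2(u+v) R(u)` for the formal series
`R(u)` with coefficients `r`. The series is multiplied termwise, and equality of both sides means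
equality of all coefficients with respect to super-symmetrized monomials, i.e. the
difference of the partial sums tends to zero. (If the metric admits only finitely many nonzero
super-symmetrized monomials, this is equality in `𝒜 ⊗ 𝒜 ⊗ ℋ`.) -/
def RLL (r : ℕ → ℂ) (u v : ℂ) : Prop :=
  ∀ n : ℕ, ∃ K₀ : ℕ, ∀ K ≥ K₀,
    S.RPartial r K * S.L 0 (u + v) * S.L 1 v - S.L 0 v * S.L 1 (u + v) * S.RPartial r K
      ∈ S.highDegree n

/-- `r_{2m} = (-4)^m Γ(m - u/2) / Γ(m + 1 + (u-ω)/2) · A`,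
`r_{2m+1} = (-4)^m Γ(m - (u-1)/2) / Γ(m + 1 + (u-ω+1)/2) · B`.
Where the denominator has a pole, the quotient is zero, in agreement with `1/Γ`. -/
def gammaCoeff (A B u : ℂ) (k : ℕ) : ℂ :=
  if Even k then
    (-4) ^ (k / 2) * (Complex.Gamma ((k / 2 : ℕ) - u / 2)
      / Complex.Gamma ((k / 2 : ℕ) + 1 + (u - S.omega) / 2)) * A
  else
    (-4) ^ (k / 2) * (Complex.Gamma ((k / 2 : ℕ) - (u - 1) / 2)
      / Complex.Gamma ((k / 2 : ℕ) + 1 + (u - S.omega + 1) / 2)) * B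

end SuperMetric

end

noncomputable section

/-! For (ii), half the sum and the difference of left multiplication and twisted right
multiplication by `c_j^a` act on the whole tensor algebra as creation and annihilation operators.
The creation operators exchange with pure signs and no contraction, so a supersymmetrized monomial
is a word of them applied to 1 (`inOsc_symProd`). The k-th invariant is therefore a sign times `zhat
^ k` applied to 1 (`invariant_eq`). Expanding left multiplication by the first invariant `z` in
these operators gives the three-term recurrence `z_mul_divPow`: each invariant is a polynomial in
`z`.

With `X_j = x_a c_j^a` and `D_j = c_j^a ∂_a`, the L-operator is `u + X_j D_j` minus half the Euler
operator (`L_eq`), and passing `z` through `X_j` or `D_j` swaps the two copies up to signs. Put `b =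
X_0 D_0 - X_1 D_1` and `d = ϵ X_1 D_0 - X_0 D_1`. Everything commuting with `z` commutes with R, and
the difference of the two sides collapses to `½(-u{R,b} + [R,b] + ϵ[R,d]z)`. The commutator with `z`
sends `b` to `2d` and `d` to `2ϵb`, so it has eigenvectors `P = d ± s b` with `s² = ϵ`, and the
relation splits into one equation for each.

After rescaling by `s`, `yP = P(y + 2)`: moving P across a polynomial in `y` shifts `y` by 2. The
rescaled polynomials `e_k` have generating function `((1 + t/2)/(1 - t/2))^y (1 - t²/4)^(ω/2)`, so
this shift multiplies it by a rational function of `t`. Hence both `{e_k, P}` and `[e_k, P](y + 1)`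
are combinations of neighbouring commutators (`anticomm_eq_of_shift`), and the recurrence for `r_k`
makes the sum telescope to two boundary terms (`sum_functional_equation`). These have high degree,
since `e_k` has degree `2k` and multiplication by a fixed element lowers degrees by a bounded amount
(`exists_mul_mem_highDegree`).

For (i), the graded antisymmetry of M reduces the six permutations to a cyclic sum, which vanishes
by normal ordering and a check of parities (`jordanSchwinger_cyclic`). The proof of (ii) does not
pass through (i). -/

theorem sgn_zero : sgn 0 = 1 := by simp [sgn]

theorem sgn_one : sgn 1 = -1 := by simp [sgn]

theorem sgn_add (x y : ZMod 2) : sgn (x + y) = sgn x * sgn y := by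
  have h : ∀ x : ZMod 2, x = 0 ∨ x = 1 := by decide
  have h2 : (1 + 1 : ZMod 2) = 0 := by decide
  rcases h x with rfl | rfl <;> rcases h y with rfl | rfl <;> simp [sgn_zero, sgn_one, h2]

theorem sgn_mul_self (x : ZMod 2) : sgn x * sgn x = 1 := by
  unfold sgn; split_ifs <;> norm_num

theorem sgn_injective {x y : ZMod 2} (h : sgn x = sgn y) : x = y := by
  have h' : ∀ x : ZMod 2, x = 0 ∨ x = 1 := by decide
  rcases h' x with rfl | rfl <;> rcases h' y with rfl | rfl <;>
    simp [sgn_zero, sgn_one] at h ⊢ <;> norm_num at h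

theorem sum_cons {ι V : Type*} [Fintype ι] [AddCommMonoid V] {k : ℕ} (F : (Fin (k + 1) → ι) → V) :
    ∑ a, F a = ∑ x, ∑ a, F (Fin.cons x a) := by
  rw [← (Fin.consEquiv fun _ => ι).sum_comp, Fintype.sum_prod_type]
  rfl

/-! ### Signs of words and super-symmetrization -/

/-- Only the diagonal and the products over unordered pairs matter. This is what sign bookkeeping
needs, because a permutation may present a given pair in either order. -/
theorem prod_prod_eq_of_pairwise {R : Type*} [CommMonoid R] {k : ℕ} {f g : Fin k → Fin k → R}
    (hd : ∀ i, f i i = g i i) (hp : ∀ i j, i < j → f i j * f j i = g i j * g j i) :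
    ∏ i, ∏ j, f i j = ∏ i, ∏ j, g i j := by
  have key : ∀ f : Fin k → Fin k → R, ∏ i, ∏ j, f i j =
      (∏ i, f i i) * ∏ i, ∏ j, if i < j then f i j * f j i else 1 := by
    intro f
    have h1 : ∀ i j, f i j = (if i = j then f i j else 1) *
        ((if i < j then f i j else 1) * (if j < i then f i j else 1)) := by
      intro i j
      rcases lt_trichotomy i j with h | h | h
      · simp [h, h.ne, h.not_gt]
      · simp [h]
      · simp [h, h.ne', h.not_gt]
    have h2 : ∀ i j, (if i < j then f i j * f j i else 1) =
        (if i < j then f i j else 1) * (if i < j then f j i else 1) := by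
      intro i j; split_ifs <;> simp
    simp_rw [h2, Finset.prod_mul_distrib]
    rw [Finset.prod_comm (f := fun i j => if i < j then f j i else 1)]
    calc ∏ i, ∏ j, f i j = ∏ i, ∏ j, ((if i = j then f i j else 1) *
        ((if i < j then f i j else 1) * (if j < i then f i j else 1))) :=
          Finset.prod_congr rfl fun i _ => Finset.prod_congr rfl fun j _ => h1 i j
      _ = _ := by
        simp_rw [Finset.prod_mul_distrib]
        simp
  rw [key f, key g]
  congr 1
  · exact Finset.prod_congr rfl fun i _ => hd i
  · refine Finset.prod_congr rfl fun i _ => Finset.prod_congr rfl fun j _ => ?_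
    split_ifs with h
    · exact hp i j h
    · rfl

section Words

variable {ι : Type*} {w : ι → ι → ℂ}

/-- The cocycle rule. A pair inverted first by one permutation and then restored by the other
contributes `w s t * w t s = 1`; every other pair is counted by at most one factor. -/
theorem wordSign_mul (hw : ∀ s t, w s t * w t s = 1) {k : ℕ} (σ ρ : Equiv.Perm (Fin k))
    (a : Fin k → ι) : wordSign w (σ * ρ) a = wordSign w σ a * wordSign w ρ (a ∘ σ) := by
  have h1 : wordSign w σ a = ∏ i, ∏ j, if ρ i < ρ j ∧ σ (ρ j) < σ (ρ i)
      then w (a (σ (ρ i))) (a (σ (ρ j))) else 1 := by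
    unfold wordSign
    rw [← Equiv.prod_comp ρ]
    refine Finset.prod_congr rfl fun i _ => ?_
    rw [← Equiv.prod_comp ρ]
  rw [h1]
  unfold wordSign
  simp_rw [← Finset.prod_mul_distrib]
  apply prod_prod_eq_of_pairwise
  · intro i; simp
  · intro i j hij
    have hne : ρ i ≠ ρ j := fun h => hij.ne (ρ.injective h)
    have hne' : σ (ρ i) ≠ σ (ρ j) := fun h => hne (σ.injective h)
    simp only [Equiv.Perm.mul_apply, Function.comp_apply, hij, hij.not_gt, true_and, false_and,
      if_false, mul_one]
    rcases lt_or_gt_of_ne hne with h | h <;> rcases lt_or_gt_of_ne hne' with h' | h' <;>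
      simp [h, h.not_gt, h', h'.not_gt, hw]

theorem wordSign_one {k : ℕ} (a : Fin k → ι) : wordSign w 1 a = 1 := by
  unfold wordSign
  refine Finset.prod_eq_one fun i _ => Finset.prod_eq_one fun j _ => ?_
  rw [if_neg]
  rintro ⟨h, h'⟩
  exact absurd h h'.not_gt

theorem wordSign_swap {n : ℕ} (i : Fin n) (a : Fin (n + 1) → ι) :
    wordSign w (Equiv.swap i.castSucc i.succ) a = w (a i.succ) (a i.castSucc) := by
  unfold wordSign
  rw [Finset.prod_eq_single i.castSucc, Finset.prod_eq_single i.succ]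
  · simp
  · intro j _ hj
    rw [if_neg]
    rintro ⟨h1, h2⟩
    rw [Equiv.swap_apply_left, Equiv.swap_apply_of_ne_of_ne h1.ne' hj] at h2
    simp only [Fin.lt_def, Fin.val_castSucc, Fin.val_succ, ne_eq, Fin.ext_iff] at *
    omega
  · simp
  · intro l _ hl
    refine Finset.prod_eq_one fun j _ => ?_
    rw [if_neg]
    rintro ⟨h1, h2⟩
    simp only [Equiv.swap_apply_def] at h2
    split_ifs at h2 <;> simp only [Fin.lt_def, Fin.val_castSucc, Fin.val_succ, ne_eq, Fin.ext_iff] at * <;> omega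
  · simp

/-- A product of elements that commute up to the factors `w` picks up the sign of the word. -/
theorem prod_ofFn_perm {B : Type*} [Ring B] [Algebra ℂ B] (hw : ∀ s t, w s t * w t s = 1)
    (v : ι → B) (hv : ∀ s t, v s * v t = w t s • (v t * v s)) {k : ℕ}
    (σ : Equiv.Perm (Fin k)) (a : Fin k → ι) :
    wordSign w σ a • (List.ofFn fun i => v (a (σ i))).prod = (List.ofFn fun i => v (a i)).prod := by
  obtain _ | n := k
  · simp [wordSign]
  have adj : ∀ (n : ℕ) (i : Fin n) (a : Fin (n + 1) → ι), w (a i.succ) (a i.castSucc) •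
      (List.ofFn fun j => v (a (Equiv.swap i.castSucc i.succ j))).prod =
      (List.ofFn fun j => v (a j)).prod := by
    intro n
    induction n with
    | zero => intro i; exact i.elim0
    | succ n ih =>
      intro i a
      refine Fin.cases ?_ (fun i => ?_) i
      · have h2 : ∀ l : Fin n, Equiv.swap (0 : Fin (n + 2)) 1 l.succ.succ = l.succ.succ := by
          intro l
          apply Equiv.swap_apply_of_ne_of_ne
          · exact Fin.succ_ne_zero _
          · exact fun h => Fin.succ_ne_zero _ (Fin.succ_injective _ h)
        simp only [List.ofFn_succ, List.prod_cons, Fin.castSucc_zero, Fin.succ_zero_eq_one,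
          Equiv.swap_apply_left, Equiv.swap_apply_right, h2]
        rw [← mul_assoc, ← mul_assoc, ← smul_mul_assoc]
        congr 1
        exact (hv _ _).symm
      · rw [List.ofFn_succ, List.ofFn_succ (f := fun j => v (a j))]
        simp only [List.prod_cons]
        have h0 : Equiv.swap i.succ.castSucc i.succ.succ 0 = 0 := by
          apply Equiv.swap_apply_of_ne_of_ne
          · simp [Fin.ext_iff]
          · exact (Fin.succ_ne_zero _).symm
        have hs : ∀ l : Fin (n + 1), Equiv.swap i.succ.castSucc i.succ.succ l.succ =
            (Equiv.swap i.castSucc i.succ l).succ := by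
          intro l
          rw [← Fin.succ_castSucc]
          exact ((Fin.succ_injective _).swap_apply _ _ _)
        simp only [h0, hs]
        have := ih i (fun j => a j.succ)
        simp only [Fin.succ_castSucc] at this
        rw [← this, mul_smul_comm]
  -- Adjacent transpositions generate the symmetric group, and the cocycle rule for signs carries
  -- the claim through products.
  have hmem : σ ∈ Submonoid.closure (Set.range fun i : Fin n => Equiv.swap i.castSucc i.succ) := by
    rw [Equiv.Perm.mclosure_swap_castSucc_succ]; trivial
  induction hmem using Submonoid.closure_induction generalizing a with
  | mem x hx =>
    obtain ⟨i, rfl⟩ := hx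
    rw [wordSign_swap, adj]
  | one => simp [wordSign_one]
  | mul x y hx hy ihx ihy =>
    rw [wordSign_mul hw, ← ihx a, mul_smul]
    exact congrArg _ (ihy (a ∘ x))

variable {V : Type*} [AddCommGroup V] [Module ℂ V]

theorem superSym_congr {k : ℕ} {f g : (Fin k → ι) → V} (h : ∀ a, f a = g a) (a : Fin k → ι) :
    superSym w f a = superSym w g a := by
  rw [funext h]

theorem map_superSym {V' : Type*} [AddCommGroup V'] [Module ℂ V'] (φ : V →ₗ[ℂ] V') {k : ℕ}
    (f : (Fin k → ι) → V) (a : Fin k → ι) :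
    φ (superSym w f a) = superSym w (fun b => φ (f b)) a := by
  simp [superSym]

/-- Averages of invariant functions. -/
theorem superSym_of_invariant {k : ℕ} {f : (Fin k → ι) → V} {a : Fin k → ι}
    (h : ∀ σ : Equiv.Perm (Fin k), wordSign w σ a • f (fun i => a (σ i)) = f a) :
    superSym w f a = f a := by
  unfold superSym
  simp_rw [h]
  rw [Finset.sum_const, Finset.card_univ, Fintype.card_perm, Fintype.card_fin,
    ← Nat.cast_smul_eq_nsmul ℂ, smul_smul, inv_mul_cancel₀, one_smul]
  exact_mod_cast k.factorial_ne_zero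

theorem superSym_precomp (hw : ∀ s t, w s t * w t s = 1) {k : ℕ} (ρ : Equiv.Perm (Fin k))
    (f : (Fin k → ι) → V) (a : Fin k → ι) :
    superSym w (fun b => wordSign w ρ b • f (b ∘ ρ)) a = superSym w f a := by
  unfold superSym
  congr 1
  rw [← Equiv.sum_comp (Equiv.mulRight ρ) fun σ => wordSign w σ a • f fun i => a (σ i)]
  refine Finset.sum_congr rfl fun σ _ => ?_
  rw [smul_smul]
  simp only [Equiv.coe_mulRight, wordSign_mul hw]
  rfl

/-- A function may be averaged over a subgroup before it is super-symmetrized. -/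
theorem superSym_average (hw : ∀ s t, w s t * w t s = 1) {k l : ℕ}
    (e : Equiv.Perm (Fin l) → Equiv.Perm (Fin k)) (f : (Fin k → ι) → V) (a : Fin k → ι) :
    superSym w (fun b => ((l.factorial : ℂ)⁻¹) •
      ∑ ρ : Equiv.Perm (Fin l), wordSign w (e ρ) b • f (b ∘ e ρ)) a = superSym w f a := by
  have hadd : superSym w (fun b => ((l.factorial : ℂ)⁻¹) •
      ∑ ρ : Equiv.Perm (Fin l), wordSign w (e ρ) b • f (b ∘ e ρ)) a =
      ((l.factorial : ℂ)⁻¹) • ∑ ρ : Equiv.Perm (Fin l),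
        superSym w (fun b => wordSign w (e ρ) b • f (b ∘ e ρ)) a := by
    unfold superSym
    rw [← Finset.smul_sum, smul_comm]
    congr 1
    rw [Finset.sum_comm, Finset.smul_sum]
    refine Finset.sum_congr rfl fun σ _ => ?_
    rw [smul_comm, Finset.smul_sum]
  rw [hadd]
  simp_rw [superSym_precomp hw]
  rw [Finset.sum_const, Finset.card_univ, Fintype.card_perm, Fintype.card_fin,
    ← Nat.cast_smul_eq_nsmul ℂ, smul_smul, inv_mul_cancel₀, one_smul]
  exact_mod_cast l.factorial_ne_zero

/-- The permutation of `Fin (k + 1)` that fixes `0` and acts as `ρ` on the other letters. -/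
def permTail {k : ℕ} (ρ : Equiv.Perm (Fin k)) : Equiv.Perm (Fin (k + 1)) :=
  Equiv.Perm.decomposeFin.symm (0, ρ)

theorem permTail_zero {k : ℕ} (ρ : Equiv.Perm (Fin k)) : permTail ρ 0 = 0 := by
  simp [permTail]

theorem permTail_succ {k : ℕ} (ρ : Equiv.Perm (Fin k)) (i : Fin k) :
    permTail ρ i.succ = (ρ i).succ := by
  simp [permTail]

theorem wordSign_permTail {k : ℕ} (ρ : Equiv.Perm (Fin k)) (b : Fin (k + 1) → ι) :
    wordSign w (permTail ρ) b = wordSign w ρ (fun i => b i.succ) := by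
  unfold wordSign
  simp [Fin.prod_univ_succ, permTail_zero, permTail_succ]

/-- The permutation of `Fin (k + 1)` that fixes the last letter and acts as `ρ` on the others. -/
def permInit {k : ℕ} (ρ : Equiv.Perm (Fin k)) : Equiv.Perm (Fin (k + 1)) :=
  Fin.revPerm * permTail (Fin.revPerm * ρ * Fin.revPerm) * Fin.revPerm

theorem permInit_last {k : ℕ} (ρ : Equiv.Perm (Fin k)) : permInit ρ (Fin.last k) = Fin.last k := by
  simp [permInit, permTail_zero]

theorem permInit_castSucc {k : ℕ} (ρ : Equiv.Perm (Fin k)) (i : Fin k) :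
    permInit ρ i.castSucc = (ρ i).castSucc := by
  simp [permInit, Fin.rev_castSucc, permTail_succ, Fin.rev_succ]

theorem wordSign_permInit {k : ℕ} (ρ : Equiv.Perm (Fin k)) (b : Fin (k + 1) → ι) :
    wordSign w (permInit ρ) b = wordSign w ρ (fun i => b i.castSucc) := by
  unfold wordSign
  simp [Fin.prod_univ_castSucc, permInit_last, permInit_castSucc, Fin.castSucc_lt_last,
    (Fin.castSucc_lt_last _).not_gt]

/-- The inverse rotation brings the last letter to the front, past each other letter exactly once.
-/
theorem wordSign_finRotate {k : ℕ} (b : Fin (k + 1) → ι) :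
    wordSign w (finRotate (k + 1))⁻¹ b = ∏ i : Fin k, w (b (Fin.last k)) (b i.castSucc) := by
  have h0 : (finRotate (k + 1))⁻¹ 0 = Fin.last k := by
    rw [Equiv.Perm.inv_eq_iff_eq]; simp
  have hs : ∀ i : Fin k, (finRotate (k + 1))⁻¹ i.succ = i.castSucc := by
    intro i
    rw [Equiv.Perm.inv_eq_iff_eq]
    ext
    simp
  unfold wordSign
  rw [Fin.prod_univ_succ, Fin.prod_univ_succ]
  have hz : ∏ i : Fin k, ∏ j : Fin (k + 1),
      (if i.succ < j ∧ (finRotate (k + 1))⁻¹ j < (finRotate (k + 1))⁻¹ i.succ then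
        w (b ((finRotate (k + 1))⁻¹ i.succ)) (b ((finRotate (k + 1))⁻¹ j)) else 1) = 1 := by
    refine Finset.prod_eq_one fun i _ => ?_
    rw [Fin.prod_univ_succ]
    simp only [hs, h0, Fin.not_lt_zero, false_and, if_false, one_mul]
    refine Finset.prod_eq_one fun j _ => if_neg ?_
    simp only [Fin.lt_def, Fin.val_succ, Fin.val_castSucc]
    omega
  rw [hz]
  simp [h0, hs, Fin.castSucc_lt_last]

end Words

namespace SuperMetric

variable {ι : Type*} [Fintype ι] [DecidableEq ι] (S : SuperMetric ι)

/-! ### Signs and the inverse metric -/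

theorem eps_mul_self : S.eps * S.eps = 1 := by
  rcases S.eps_eq with h | h <;> rw [h] <;> norm_num

theorem exch_comm (a b : ι) : S.exch a b = S.exch b a := by
  simp [exch, mul_comm (S.deg a)]

theorem exch_mul_self (a b : ι) : S.exch a b * S.exch a b = 1 := by
  have h1 := S.eps_mul_self
  have h2 := sgn_mul_self (S.deg a * S.deg b)
  unfold exch
  linear_combination sgn (S.deg a * S.deg b) ^ 2 * h1 + h2

theorem exchM_comm (a b : ι) : S.exchM a b = S.exchM b a := by
  simp only [exchM, mul_comm (S.deg a)]
  rw [add_right_comm]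

theorem deg_cases (a : ι) : S.deg a = 0 ∨ S.deg a = 1 := by
  have h : ∀ x : ZMod 2, x = 0 ∨ x = 1 := by decide
  exact h _

theorem deg_eq_of_g {a b : ι} (h : S.g a b ≠ 0) : S.deg a = S.deg b := by
  have h' : ∀ x y : ZMod 2, x + y = 0 → x = y := by decide
  exact h' _ _ (S.even a b h)

theorem g_swap (a b : ι) : S.g b a = S.eps * (sgn (S.deg a) * S.g a b) := by
  rw [S.symm b a]
  by_cases h : S.g a b = 0
  · simp [h]
  · rw [← S.deg_eq_of_g h]
    have h' : ∀ x : ZMod 2, x * x = x := by decide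
    rw [h', mul_assoc]

theorem g_mul_ginv : S.g * S.g⁻¹ = 1 := Matrix.mul_nonsing_inv _ S.nondeg

theorem ginv_mul_g : S.g⁻¹ * S.g = 1 := Matrix.nonsing_inv_mul _ S.nondeg

/-- Evenness of the metric says that it commutes with the parity matrix `D`; its inverse then
commutes with `D` too. -/
theorem deg_eq_of_ginv {a b : ι} (h : S.g⁻¹ a b ≠ 0) : S.deg a = S.deg b := by
  set D : Matrix ι ι ℂ := Matrix.diagonal fun a => sgn (S.deg a) with hD
  have h1 : D * S.g = S.g * D := by
    ext a b
    rw [hD, Matrix.diagonal_mul, Matrix.mul_diagonal]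
    by_cases h : S.g a b = 0
    · simp [h]
    · rw [S.deg_eq_of_g h, mul_comm]
  have h2 : D * S.g⁻¹ = S.g⁻¹ * D := by
    calc D * S.g⁻¹ = S.g⁻¹ * S.g * D * S.g⁻¹ := by rw [S.ginv_mul_g, one_mul]
      _ = S.g⁻¹ * D * (S.g * S.g⁻¹) := by rw [mul_assoc S.g⁻¹, ← h1]; simp only [mul_assoc]
      _ = S.g⁻¹ * D := by rw [S.g_mul_ginv, mul_one]
  have h3 := congrFun (congrFun h2 a) b
  rw [hD, Matrix.diagonal_mul, Matrix.mul_diagonal, mul_comm] at h3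
  exact sgn_injective (mul_left_cancel₀ h h3)

theorem ginv_swap (a b : ι) : S.g⁻¹ b a = S.eps * (sgn (S.deg a) * S.g⁻¹ a b) := by
  set D : Matrix ι ι ℂ := Matrix.diagonal fun a => sgn (S.deg a) with hD
  have hDD : D * D = 1 := by
    rw [hD, Matrix.diagonal_mul_diagonal]
    simp [sgn_mul_self]
  have h1 : S.g.transpose = S.eps • (D * S.g) := by
    ext a b
    rw [hD, Matrix.smul_apply, Matrix.diagonal_mul, Matrix.transpose_apply, smul_eq_mul,
      S.g_swap a b]
  have h2 : S.g⁻¹.transpose = S.eps • (S.g⁻¹ * D) := by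
    have h3 : S.g.transpose * (S.eps • (S.g⁻¹ * D)) = 1 := by
      rw [h1, Matrix.smul_mul, Matrix.mul_smul, smul_smul, S.eps_mul_self, one_smul,
        mul_assoc, ← mul_assoc S.g, S.g_mul_ginv, one_mul, hDD]
    rw [Matrix.transpose_nonsing_inv]
    exact (Matrix.inv_eq_right_inv h3)
  have h3 := congrFun (congrFun h2 a) b
  rw [Matrix.transpose_apply, hD, Matrix.smul_apply, Matrix.mul_diagonal, smul_eq_mul] at h3
  rw [h3]
  by_cases h : S.g⁻¹ a b = 0
  · simp [h]
  · rw [S.deg_eq_of_ginv h]; ring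

theorem ginv_symm (a b : ι) : S.g⁻¹ a b = S.exch a b * S.g⁻¹ b a := by
  rw [S.ginv_swap b a, exch]
  by_cases h : S.g⁻¹ b a = 0
  · simp [h]
  · have h' : ∀ x : ZMod 2, x * x = x := by decide
    rw [S.deg_eq_of_ginv h, h', mul_assoc]

theorem sum_ginv_g (a c : ι) : ∑ b, S.g⁻¹ a b * S.g b c = if a = c then 1 else 0 := by
  rw [← Matrix.mul_apply, S.ginv_mul_g, Matrix.one_apply]

theorem sum_g_ginv (a c : ι) : ∑ b, S.g a b * S.g⁻¹ b c = if a = c then 1 else 0 := by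
  rw [← Matrix.mul_apply, S.g_mul_ginv, Matrix.one_apply]

/-! ### Generators of the graded tensor product -/

/-- The generator `c_j^a` of the graded tensor product. -/
def osc (v : Fin 2 × ι) : S.Tensor := S.inOsc v.1 (S.c v.2)

/-- A generator `x_a` or `∂_a` of the graded tensor product. -/
def hgen (y : ι ⊕ ι) : S.Tensor := S.inHeis (RingQuot.mkAlgHom ℂ S.HeisRel (FreeAlgebra.ι ℂ y))

theorem osc_eq (v : Fin 2 × ι) :
    S.osc v = RingQuot.mkAlgHom ℂ S.TensorRel (FreeAlgebra.ι ℂ (Sum.inl v)) := by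
  exact (RingQuot.liftAlgHom_mkAlgHom_apply ℂ _ _ _).trans (by simp)

theorem hgen_eq (y : ι ⊕ ι) :
    S.hgen y = RingQuot.mkAlgHom ℂ S.TensorRel (FreeAlgebra.ι ℂ (Sum.inr y)) := by
  exact (RingQuot.liftAlgHom_mkAlgHom_apply ℂ _ _ _).trans (by simp)

/-- The commutation factor of `c_j^a` and `c_l^b` up to contractions. -/
def fac (v v' : Fin 2 × ι) : ℂ :=
  if v.1 = v'.1 then -S.exch v.2 v'.2 else sgn (S.deg v.2 * S.deg v'.2)

/-- The contraction of `c_j^a` and `c_l^b`. -/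
def con (v v' : Fin 2 × ι) : ℂ := if v.1 = v'.1 then S.g⁻¹ v.2 v'.2 else 0

theorem fac_comm (v v' : Fin 2 × ι) : S.fac v v' = S.fac v' v := by
  simp only [fac, eq_comm (a := v.1), S.exch_comm v.2, mul_comm (S.deg v.2)]

theorem fac_mul_self (v v' : Fin 2 × ι) : S.fac v v' * S.fac v v' = 1 := by
  unfold fac
  split_ifs
  · rw [neg_mul_neg, exch_mul_self]
  · exact sgn_mul_self _

theorem fac_mul_fac (v v' : Fin 2 × ι) : S.fac v v' * S.fac v' v = 1 := by
  rw [S.fac_comm v' v, fac_mul_self]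

theorem osc_mul (v v' : Fin 2 × ι) :
    S.osc v * S.osc v' = S.con v v' • 1 + S.fac v v' • (S.osc v' * S.osc v) := by
  obtain ⟨j, a⟩ := v
  obtain ⟨l, b⟩ := v'
  have hcross : S.osc (0, a) * S.osc (1, b) =
      sgn (S.deg a * S.deg b) • (S.osc (1, b) * S.osc (0, a)) := by
    have := RingQuot.mkAlgHom_rel ℂ (TensorRel.cross_osc (S := S) a b)
    simpa [osc_eq] using this
  have hcross' : S.osc (1, a) * S.osc (0, b) =
      sgn (S.deg a * S.deg b) • (S.osc (0, b) * S.osc (1, a)) := by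
    have := RingQuot.mkAlgHom_rel ℂ (TensorRel.cross_osc (S := S) b a)
    simp only [map_mul, map_smul, ← osc_eq] at this
    rw [this, smul_smul, mul_comm (S.deg a), sgn_mul_self, one_smul]
  by_cases h : j = l
  · subst h
    have := RingQuot.mkAlgHom_rel ℂ (TensorRel.osc (S := S) j (OscRel.rel a b))
    simp only [map_mul, map_smul, map_add, FreeAlgebra.lift_ι_apply, ← osc_eq,
      Algebra.algebraMap_eq_smul_one, map_one] at this
    simp only [con, fac, if_true, ← this]
    module
  · have hc : (j = 0 ∧ l = 1) ∨ (j = 1 ∧ l = 0) := by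
      clear hcross hcross'; revert j l; decide
    rcases hc with ⟨rfl, rfl⟩ | ⟨rfl, rfl⟩
    · simpa [con, fac] using hcross
    · simpa [con, fac] using hcross'

theorem osc_mul_hgen (v : Fin 2 × ι) (y : ι ⊕ ι) :
    S.osc v * S.hgen y = sgn (S.deg v.2 * S.degH y) • (S.hgen y * S.osc v) := by
  have := RingQuot.mkAlgHom_rel ℂ (TensorRel.cross_heis (S := S) v.1 v.2 y)
  simpa [osc_eq, hgen_eq] using this

theorem hgen_mul_osc (v : Fin 2 × ι) (y : ι ⊕ ι) :
    S.hgen y * S.osc v = sgn (S.deg v.2 * S.degH y) • (S.osc v * S.hgen y) := by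
  rw [osc_mul_hgen, smul_smul, sgn_mul_self, one_smul]

/-- The graded tensor product is generated by the `c_j^a`, `x_a` and `∂_a`. -/
theorem adjoin_generators :
    Algebra.adjoin ℂ (Set.range S.osc ∪ Set.range S.hgen) = ⊤ := by
  rw [eq_top_iff]
  rintro t -
  obtain ⟨f, rfl⟩ := RingQuot.mkAlgHom_surjective ℂ S.TensorRel t
  induction f using FreeAlgebra.induction with
  | grade0 r => rw [AlgHom.commutes]; exact Subalgebra.algebraMap_mem _ r
  | grade1 Y =>
    apply Algebra.subset_adjoin
    rcases Y with v | y
    · exact Or.inl ⟨v, S.osc_eq v⟩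
    · exact Or.inr ⟨y, S.hgen_eq y⟩
  | mul a b ha hb => rw [map_mul]; exact Subalgebra.mul_mem _ ha hb
  | add a b ha hb => rw [map_add]; exact Subalgebra.add_mem _ ha hb

theorem heis_induction {p : S.Heis → Prop} (hs : ∀ r, p (algebraMap ℂ _ r))
    (hg : ∀ y, p (RingQuot.mkAlgHom ℂ S.HeisRel (FreeAlgebra.ι ℂ y)))
    (hm : ∀ a b, p a → p b → p (a * b)) (ha : ∀ a b, p a → p b → p (a + b)) (h : S.Heis) : p h := by
  obtain ⟨f, rfl⟩ := RingQuot.mkAlgHom_surjective ℂ S.HeisRel h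
  induction f using FreeAlgebra.induction with
  | grade0 r => rw [AlgHom.commutes]; exact hs r
  | grade1 y => exact hg y
  | mul a b h1 h2 => rw [map_mul]; exact hm _ _ h1 h2
  | add a b h1 h2 => rw [map_add]; exact ha _ _ h1 h2

/-! ### Twists and Fock operators -/

/-- The factor which `c_j^a` acquires when it is commuted with a generator, up to contractions. -/
def genFac (v : Fin 2 × ι) : Gen ι → ℂ :=
  Sum.elim (S.fac v) fun y => sgn (S.deg v.2 * S.degH y)

/-- A nonzero contraction forces equal copies and equal degrees, so the two signs coincide and
square to 1. This makes the twist compatible with the constant terms of the relations and lets two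
twists cancel beside a contraction. -/
theorem genFac_mul_of_con (Y : Gen ι) {v v' : Fin 2 × ι} (h : S.con v v' ≠ 0) :
    S.genFac v Y * S.genFac v' Y = 1 := by
  have h1 : v.1 = v'.1 := by by_contra h1; simp [con, h1] at h
  have h2 : S.deg v.2 = S.deg v'.2 := by
    rw [con, if_pos h1] at h; exact S.deg_eq_of_ginv h
  have : S.genFac v Y = S.genFac v' Y := by
    rcases Y with v'' | y <;> simp [genFac, fac, exch, h1, h2]
  rw [this]
  rcases Y with v'' | y
  · exact S.fac_mul_self _ _
  · exact sgn_mul_self _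

theorem genFac_twist_rel (v : Fin 2 × ι) {s t : FreeAlgebra ℂ (Gen ι)} (h : S.TensorRel s t) :
    FreeAlgebra.lift ℂ (fun Y => S.genFac v Y •
      RingQuot.mkAlgHom ℂ S.TensorRel (FreeAlgebra.ι ℂ Y)) s =
    FreeAlgebra.lift ℂ (fun Y => S.genFac v Y •
      RingQuot.mkAlgHom ℂ S.TensorRel (FreeAlgebra.ι ℂ Y)) t := by
  have hr := RingQuot.mkAlgHom_rel ℂ h
  cases h with
  | osc j h =>
    obtain ⟨a, b⟩ := h
    simp only [map_mul, map_smul, map_add, FreeAlgebra.lift_ι_apply, AlgHom.commutes,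
      smul_mul_smul_comm] at hr ⊢
    rw [mul_comm (S.genFac v (Sum.inl (j, b))), smul_comm (S.exch a b), ← smul_add, hr]
    by_cases h : S.g⁻¹ a b = 0
    · simp [h]
    · have h1 : S.genFac v (Sum.inl (j, a)) * S.genFac v (Sum.inl (j, b)) = 1 := by
        simp only [genFac, Sum.elim_inl]
        rw [S.fac_comm v, S.fac_comm v]
        exact S.genFac_mul_of_con (Sum.inl v) (by simpa [con] using h)
      rw [h1, one_smul]
  | heis h =>
    cases h with
    | xx a b =>
      simp only [map_mul, map_smul, FreeAlgebra.lift_ι_apply, smul_mul_smul_comm] at hr ⊢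
      rw [hr, mul_comm, smul_comm]
    | dd a b =>
      simp only [map_mul, map_smul, FreeAlgebra.lift_ι_apply, smul_mul_smul_comm] at hr ⊢
      rw [hr, mul_comm, smul_comm]
    | dx a b =>
      simp only [map_mul, map_smul, map_sub, FreeAlgebra.lift_ι_apply, AlgHom.commutes,
        smul_mul_smul_comm] at hr ⊢
      rw [sub_eq_iff_eq_add] at hr ⊢
      rw [mul_comm (S.genFac v (Sum.inr (Sum.inl b))), smul_comm (S.exch a b), hr, smul_add,
        add_left_inj]
      by_cases h : S.g a b = 0
      · simp [h]
      · have h1 : S.genFac v (Sum.inr (Sum.inr a)) * S.genFac v (Sum.inr (Sum.inl b)) = 1 := by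
          simp [genFac, degH, S.deg_eq_of_g h, sgn_mul_self]
        rw [h1, one_smul]
  | cross_osc a b =>
    simp only [map_mul, map_smul, FreeAlgebra.lift_ι_apply, smul_mul_smul_comm] at hr ⊢
    rw [hr, mul_comm, smul_comm]
  | cross_heis j a y =>
    simp only [map_mul, map_smul, FreeAlgebra.lift_ι_apply, smul_mul_smul_comm] at hr ⊢
    rw [hr, mul_comm, smul_comm]

/-- The endomorphism that multiplies every generator by its commutation factor with `c_j^a`. -/
def twist (v : Fin 2 × ι) : S.Tensor →ₐ[ℂ] S.Tensor :=
  RingQuot.liftAlgHom ℂ ⟨FreeAlgebra.lift ℂ (fun Y => S.genFac v Y •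
      RingQuot.mkAlgHom ℂ S.TensorRel (FreeAlgebra.ι ℂ Y)), fun _ _ h => S.genFac_twist_rel v h⟩

theorem twist_osc (v v' : Fin 2 × ι) : S.twist v (S.osc v') = S.fac v v' • S.osc v' := by
  simp [twist, osc_eq, genFac]

theorem twist_hgen (v : Fin 2 × ι) (y : ι ⊕ ι) :
    S.twist v (S.hgen y) = sgn (S.deg v.2 * S.degH y) • S.hgen y := by
  simp [twist, hgen_eq, genFac]

theorem twist_gen (v : Fin 2 × ι) (Y : Gen ι) :
    S.twist v (RingQuot.mkAlgHom ℂ S.TensorRel (FreeAlgebra.ι ℂ Y)) =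
      S.genFac v Y • RingQuot.mkAlgHom ℂ S.TensorRel (FreeAlgebra.ι ℂ Y) := by
  simp [twist]

theorem tensor_hom_ext {f f' : S.Tensor →ₐ[ℂ] S.Tensor}
    (h : ∀ Y, f (RingQuot.mkAlgHom ℂ S.TensorRel (FreeAlgebra.ι ℂ Y)) =
      f' (RingQuot.mkAlgHom ℂ S.TensorRel (FreeAlgebra.ι ℂ Y))) : f = f' := by
  apply RingQuot.ringQuot_ext' ℂ
  apply FreeAlgebra.hom_ext
  funext Y
  exact h Y

theorem twist_twist_comm (v v' : Fin 2 × ι) (t : S.Tensor) :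
    S.twist v (S.twist v' t) = S.twist v' (S.twist v t) := by
  rw [← AlgHom.comp_apply, ← AlgHom.comp_apply]
  congr 1
  apply S.tensor_hom_ext
  intro Y
  simp [twist_gen, smul_smul, mul_comm]

theorem twist_twist_of_con {v v' : Fin 2 × ι} (h : S.con v v' ≠ 0) (t : S.Tensor) :
    S.twist v (S.twist v' t) = t := by
  rw [← AlgHom.comp_apply]
  conv_rhs => rw [← AlgHom.id_apply (R := ℂ) t]
  congr 1
  apply S.tensor_hom_ext
  intro Y
  simp [twist_gen, smul_smul, mul_comm (S.genFac v' Y), S.genFac_mul_of_con Y h]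

theorem twist_twist_self (v : Fin 2 × ι) (t : S.Tensor) : S.twist v (S.twist v t) = t := by
  rw [← AlgHom.comp_apply]
  conv_rhs => rw [← AlgHom.id_apply (R := ℂ) t]
  congr 1
  apply S.tensor_hom_ext
  intro Y
  have : S.genFac v Y * S.genFac v Y = 1 := by
    rcases Y with v'' | y
    · exact S.fac_mul_self _ _
    · exact sgn_mul_self _
  simp [twist_gen, smul_smul, this]

/-- Left multiplication by `c_j^a`. -/
def lop (v : Fin 2 × ι) : Module.End ℂ S.Tensor := LinearMap.mulLeft ℂ (S.osc v)

/-- Twisted right multiplication by `c_j^a`. -/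
def rop (v : Fin 2 × ι) : Module.End ℂ S.Tensor :=
  LinearMap.mulRight ℂ (S.osc v) ∘ₗ (S.twist v).toLinearMap

/-- The creation operator of `c_j^a`. -/
def cre (v : Fin 2 × ι) : Module.End ℂ S.Tensor := (1 / 2 : ℂ) • (S.lop v + S.rop v)

/-- The annihilation operator of `c_j^a`. -/
def ann (v : Fin 2 × ι) : Module.End ℂ S.Tensor := S.lop v + (-1 : ℂ) • S.rop v

theorem lop_apply (v : Fin 2 × ι) (t : S.Tensor) : S.lop v t = S.osc v * t := rfl

theorem rop_apply (v : Fin 2 × ι) (t : S.Tensor) : S.rop v t = S.twist v t * S.osc v := rfl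

theorem lop_eq (v : Fin 2 × ι) : S.lop v = S.cre v + (1 / 2 : ℂ) • S.ann v := by
  unfold cre ann; module

theorem rop_eq (v : Fin 2 × ι) : S.rop v = S.cre v + (-1 / 2 : ℂ) • S.ann v := by
  unfold cre ann; module

theorem lop_lop (v v' : Fin 2 × ι) :
    S.lop v * S.lop v' = S.con v v' • 1 + S.fac v v' • (S.lop v' * S.lop v) := by
  ext t
  simp only [Module.End.mul_apply, LinearMap.add_apply, LinearMap.smul_apply, lop_apply,
    Module.End.one_apply]
  rw [← mul_assoc, osc_mul, add_mul, smul_mul_assoc, one_mul, smul_mul_assoc, mul_assoc]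

/-- The contraction has the opposite sign to the one in `lop_lop`, because right multiplication
reverses the order. The Fock relations rest on this: contractions cancel between two creation
operators and add up to a full one between `ann` and `cre`. -/
theorem rop_rop (v v' : Fin 2 × ι) :
    S.rop v * S.rop v' = -S.con v v' • 1 + S.fac v v' • (S.rop v' * S.rop v) := by
  ext t
  simp only [Module.End.mul_apply, LinearMap.add_apply, LinearMap.smul_apply, rop_apply,
    Module.End.one_apply, map_mul, twist_osc]
  rw [S.twist_twist_comm v' v, mul_smul_comm, mul_smul_comm, smul_mul_assoc, smul_mul_assoc,
    smul_smul, S.fac_comm v' v, fac_mul_self, one_smul, mul_assoc, mul_assoc, S.osc_mul v v',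
    mul_add, mul_smul_comm, mul_smul_comm, mul_one]
  by_cases h : S.con v v' = 0
  · simp [h]
  · rw [S.twist_twist_of_con h]
    module


theorem lop_rop (v v' : Fin 2 × ι) :
    S.lop v * S.rop v' = S.fac v v' • (S.rop v' * S.lop v) := by
  ext t
  simp only [Module.End.mul_apply, LinearMap.smul_apply, lop_apply, rop_apply, map_mul, twist_osc]
  rw [smul_mul_assoc, smul_mul_assoc, smul_smul, fac_mul_fac, one_smul, mul_assoc]

theorem rop_lop (v v' : Fin 2 × ι) :
    S.rop v * S.lop v' = S.fac v v' • (S.lop v' * S.rop v) := by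
  rw [lop_rop, smul_smul, fac_mul_fac, one_smul]

theorem cre_cre (v v' : Fin 2 × ι) :
    S.cre v * S.cre v' = S.fac v v' • (S.cre v' * S.cre v) := by
  simp only [cre, smul_mul_smul_comm, mul_add, add_mul]
  rw [S.lop_lop v v', S.rop_rop v v', S.lop_rop v v', S.rop_lop v v']
  module

theorem ann_cre (v v' : Fin 2 × ι) :
    S.ann v * S.cre v' = S.con v v' • 1 + S.fac v v' • (S.cre v' * S.ann v) := by
  simp only [cre, ann, smul_mul_assoc, mul_smul_comm, mul_add, add_mul]
  rw [S.lop_lop v v', S.rop_rop v v', S.lop_rop v v', S.rop_lop v v']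
  module

theorem ann_apply (v : Fin 2 × ι) (t : S.Tensor) :
    S.ann v t = S.osc v * t - S.twist v t * S.osc v := by
  rw [sub_eq_add_neg, ← neg_one_smul ℂ (S.twist v t * S.osc v)]
  rfl

theorem ann_one (v : Fin 2 × ι) : S.ann v 1 = 0 := by
  rw [ann_apply, map_one, one_mul, mul_one, sub_self]

/-- `ann v` is a derivation twisted by `twist v`; only the case where its first term vanishes is
needed. -/
theorem ann_mul {v : Fin 2 × ι} {t : S.Tensor} (t' : S.Tensor) (h : S.ann v t = 0) :
    S.ann v (t * t') = S.twist v t * S.ann v t' := by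
  rw [ann_apply, sub_eq_zero] at h
  rw [ann_apply, ann_apply, map_mul, mul_sub, ← mul_assoc, h, mul_assoc, mul_assoc]

theorem ann_mul_eq_zero {v : Fin 2 × ι} {t t' : S.Tensor} (h : S.ann v t = 0)
    (h' : S.ann v t' = 0) : S.ann v (t * t') = 0 := by
  rw [S.ann_mul t' h, h', mul_zero]

theorem rop_mul {v : Fin 2 × ι} (t : S.Tensor) {t' : S.Tensor} (h : S.ann v t' = 0) :
    S.rop v (t * t') = S.rop v t * t' := by
  rw [ann_apply, sub_eq_zero] at h
  rw [rop_apply, rop_apply, map_mul, mul_assoc, mul_assoc, h]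

theorem lop_mul (v : Fin 2 × ι) (t t' : S.Tensor) : S.lop v (t * t') = S.lop v t * t' := by
  rw [lop_apply, lop_apply, mul_assoc]

/-- An element killed by `ann v` exchanges with `c_j^a` by the twist alone, so twisted right
multiplication passes through it. This later factors products over the two copies and over `ℋ`. -/
theorem cre_mul {v : Fin 2 × ι} (t : S.Tensor) {t' : S.Tensor} (h : S.ann v t' = 0) :
    S.cre v (t * t') = S.cre v t * t' := by
  simp only [cre, LinearMap.smul_apply, LinearMap.add_apply]
  rw [S.rop_mul t h, S.lop_mul, smul_mul_assoc, add_mul]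

theorem ann_hgen (v : Fin 2 × ι) (y : ι ⊕ ι) : S.ann v (S.hgen y) = 0 := by
  rw [ann_apply, twist_hgen, osc_mul_hgen, smul_mul_assoc, sub_self]

theorem ann_inHeis (v : Fin 2 × ι) (h : S.Heis) : S.ann v (S.inHeis h) = 0 := by
  induction h using S.heis_induction with
  | hs r =>
    rw [AlgHom.commutes, Algebra.algebraMap_eq_smul_one, map_smul, ann_one, smul_zero]
  | hg y => exact S.ann_hgen v y
  | hm a b ha hb => rw [map_mul, S.ann_mul_eq_zero ha hb]
  | ha a b ha hb => rw [map_add, map_add, ha, hb, add_zero]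

/-! ### Super-symmetrized products as words of creation operators -/

/-- The word `c_j^{a_1} ⋯ c_j^{a_k}`. -/
def oscWord (j : Fin 2) {k : ℕ} (a : Fin k → ι) : S.Tensor :=
  (List.ofFn fun i => S.osc (j, a i)).prod

/-- The word of creation operators of `c_j^{a_1}, …, c_j^{a_k}`. -/
def creOp (j : Fin 2) {k : ℕ} (a : Fin k → ι) : Module.End ℂ S.Tensor :=
  (List.ofFn fun i => S.cre (j, a i)).prod

/-- The word of creation operators of `c_j^{a_1}, …, c_j^{a_k}`, applied to `1`. -/
def creWord (j : Fin 2) {k : ℕ} (a : Fin k → ι) : S.Tensor := S.creOp j a 1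

theorem creOp_succ (j : Fin 2) {k : ℕ} (a : Fin (k + 1) → ι) :
    S.creOp j a = S.cre (j, a 0) * S.creOp j fun i => a i.succ := by
  simp [creOp, List.ofFn_succ]

theorem creWord_succ (j : Fin 2) {k : ℕ} (a : Fin (k + 1) → ι) :
    S.creWord j a = S.cre (j, a 0) (S.creWord j fun i => a i.succ) := by
  rw [creWord, creOp_succ]; rfl

theorem creWord_zero (j : Fin 2) (a : Fin 0 → ι) : S.creWord j a = 1 := by
  simp [creWord, creOp]

theorem neg_exch_mul (s t : ι) : -S.exch s t * -S.exch t s = 1 := by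
  rw [S.exch_comm t s, neg_mul_neg, exch_mul_self]

theorem inOsc_symProd_eq_superSym (j : Fin 2) {k : ℕ} (a : Fin k → ι) :
    S.inOsc j (S.symProd a) = superSym (fun s t => -S.exch s t) (S.oscWord j) a := by
  have h := map_superSym (w := fun s t => -S.exch s t) (S.inOsc j).toLinearMap
    (fun b : Fin k → ι => (List.ofFn fun i => S.c (b i)).prod) a
  refine h.trans (superSym_congr (fun b => ?_) a)
  rw [AlgHom.toLinearMap_apply, map_list_prod, List.map_ofFn]
  rfl

theorem twist_cre (v v' : Fin 2 × ι) (t : S.Tensor) :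
    S.twist v (S.cre v' t) = S.fac v v' • S.cre v' (S.twist v t) := by
  simp only [cre, LinearMap.smul_apply, LinearMap.add_apply, lop_apply, rop_apply, map_smul,
    map_add, map_mul, twist_osc, smul_mul_assoc, mul_smul_comm]
  rw [S.twist_twist_comm v v']
  module

theorem twist_creWord (v : Fin 2 × ι) (j : Fin 2) {k : ℕ} (a : Fin k → ι) :
    S.twist v (S.creWord j a) = (∏ i, S.fac v (j, a i)) • S.creWord j a := by
  induction k with
  | zero => simp [creWord_zero]
  | succ k ih =>
    rw [creWord_succ, twist_cre, ih, map_smul, smul_smul, Fin.prod_univ_succ]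

theorem superSym_creWord (j : Fin 2) {k : ℕ} (a : Fin k → ι) :
    superSym (fun s t => -S.exch s t) (S.creWord j) a = S.creWord j a := by
  apply superSym_of_invariant
  intro σ
  have h := prod_ofFn_perm (w := fun s t => -S.exch s t) S.neg_exch_mul (fun s => S.cre (j, s))
    (fun s t => by rw [cre_cre]; simp [fac, S.exch_comm s t]) σ a
  exact LinearMap.congr_fun h 1

/-- The sign of rotating the last letter to the front equals the twist factor of the remaining word,
and the two cancel. -/
theorem rop_creWord (j : Fin 2) {k : ℕ} (b : Fin (k + 1) → ι) :
    S.creWord j (fun i => b i.castSucc) * S.osc (j, b (Fin.last k)) =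
      wordSign (fun s t => -S.exch s t) (finRotate (k + 1))⁻¹ b •
        S.rop (j, (b ∘ ((finRotate (k + 1))⁻¹ : Equiv.Perm (Fin (k + 1)))) 0)
          (S.creWord j fun i => (b ∘ ((finRotate (k + 1))⁻¹ : Equiv.Perm (Fin (k + 1)))) i.succ) := by
  have h0 : (finRotate (k + 1))⁻¹ 0 = Fin.last k := by
    rw [Equiv.Perm.inv_eq_iff_eq]; simp
  have hs : ∀ i : Fin k, (finRotate (k + 1))⁻¹ i.succ = i.castSucc := by
    intro i
    rw [Equiv.Perm.inv_eq_iff_eq]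
    ext
    simp
  simp only [Function.comp_apply, h0, hs]
  rw [rop_apply, twist_creWord, smul_mul_assoc, smul_smul, wordSign_finRotate,
    ← Finset.prod_mul_distrib, Finset.prod_eq_one, one_smul]
  intro i _
  simp [fac, exch_mul_self]

/-- Super-symmetrized products of super-oscillators are words of creation operators. -/
theorem inOsc_symProd (j : Fin 2) {k : ℕ} (a : Fin k → ι) :
    S.inOsc j (S.symProd a) = S.creWord j a := by
  rw [inOsc_symProd_eq_superSym]
  induction k with
  | zero =>
    rw [superSym_of_invariant, creWord_zero]
    · simp [oscWord]
    · intro σ; simp [wordSign, oscWord]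
  | succ k ih =>
    set w : ι → ι → ℂ := fun s t => -S.exch s t with hw
    -- Averaging first over permutations of the tail replaces the tail by a creation word, leaving
    -- left multiplication by the first letter.
    have hL : superSym w (S.oscWord j) a =
        superSym w (fun b => S.lop (j, b 0) (S.creWord j fun i => b i.succ)) a := by
      rw [← superSym_average S.neg_exch_mul permTail (S.oscWord j)]
      refine superSym_congr (fun b => ?_) a
      rw [← ih, lop_apply, superSym, mul_smul_comm, Finset.mul_sum]
      congr 1
      refine Finset.sum_congr rfl fun ρ _ => ?_
      rw [wordSign_permTail, mul_smul_comm]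
      congr 1
      simp [oscWord, List.ofFn_succ, permTail_zero, permTail_succ]
    -- The mirror image: the initial segment is averaged, and the last letter is rotated to the
    -- front as a twisted right multiplication.
    have hR : superSym w (S.oscWord j) a =
        superSym w (fun b => S.rop (j, b 0) (S.creWord j fun i => b i.succ)) a := by
      rw [← superSym_precomp S.neg_exch_mul (finRotate (k + 1))⁻¹
          (fun b => S.rop (j, b 0) (S.creWord j fun i => b i.succ)),
        ← superSym_average S.neg_exch_mul permInit (S.oscWord j)]
      refine superSym_congr (fun b => ?_) a
      rw [← rop_creWord, ← ih, superSym, smul_mul_assoc, Finset.sum_mul]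
      congr 1
      refine Finset.sum_congr rfl fun ρ _ => ?_
      rw [wordSign_permInit, smul_mul_assoc]
      congr 1
      simp only [oscWord, Function.comp_apply]
      rw [List.ofFn_succ', List.concat_eq_append, List.prod_append, List.prod_singleton]
      simp only [permInit_last, permInit_castSucc]
    have hC : superSym w (S.oscWord j) a + superSym w (S.oscWord j) a =
        (2 : ℂ) • superSym w (S.creWord j) a := by
      have key : ∀ σ : Equiv.Perm (Fin (k + 1)),
          wordSign w σ a • S.lop (j, a (σ 0)) (S.creWord j fun i => a (σ i.succ)) +
            wordSign w σ a • S.rop (j, a (σ 0)) (S.creWord j fun i => a (σ i.succ)) =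
          (2 : ℂ) • wordSign w σ a • S.creWord j fun i => a (σ i) := by
        intro σ
        rw [creWord_succ, cre, LinearMap.smul_apply, LinearMap.add_apply]
        module
      refine (congrArg₂ (· + ·) hL hR).trans ?_
      simp only [superSym]
      rw [← smul_add, ← Finset.sum_add_distrib, Finset.sum_congr rfl fun σ _ => key σ,
        ← Finset.smul_sum, smul_comm]
    rw [← two_smul ℂ, S.superSym_creWord] at hC
    exact smul_right_injective _ (two_ne_zero (α := ℂ)) hC

/-! ### The invariants as powers of a creation operator -/

/-- Contraction of two families of operators with the metric. -/
def pair {B : Type*} [Semiring B] [Algebra ℂ B] (f f' : ι → B) : B :=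
  ∑ a, ∑ b, S.g a b • (f a * f' b)

theorem pair_swap {B : Type*} [Semiring B] [Algebra ℂ B] (f f' : ι → B) :
    ∑ a, ∑ b, (S.exch a b * S.g a b) • (f b * f' a) = S.pair f f' := by
  rw [Finset.sum_comm]
  refine Finset.sum_congr rfl fun a _ => Finset.sum_congr rfl fun b _ => ?_
  rw [S.symm a b, S.exch_comm b a]
  rfl

/-- The operator of multiplication by the first invariant in the algebra of symbols. -/
def zhat : Module.End ℂ S.Tensor := S.pair (fun a => S.cre (0, a)) fun b => S.cre (1, b)

theorem fac_pair (v : Fin 2 × ι) {a b : ι} (h : S.deg a = S.deg b) :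
    S.fac v (0, a) * S.fac v (1, b) = -S.eps := by
  obtain ⟨j, c⟩ := v
  have h2 := sgn_mul_self (S.deg c * S.deg b)
  fin_cases j <;> simp [fac, exch, h] <;> linear_combination S.eps * h2

/-! ### Passing an operator through a metric contraction -/

section MulPair

variable {B : Type*} [Semiring B] [Algebra ℂ B] {C : Fin 2 × ι → B} {O : B}

/-- Kept general in `C` and `O` since it serves twice: for creation and annihilation operators
meeting `zhat`, and for the oscillators themselves meeting `z`. -/
theorem mul_pair (v : Fin 2 × ι) {f : Fin 2 × ι → ℂ}
    (hO : ∀ v', O * C v' = f v' • 1 + S.fac v v' • (C v' * O)) :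
    O * S.pair (fun a => C (0, a)) (fun b => C (1, b)) =
      (-S.eps) • (S.pair (fun a => C (0, a)) (fun b => C (1, b)) * O) +
      ∑ a, ∑ b, (S.g a b * f (0, a)) • C (1, b) +
      ∑ a, ∑ b, (S.g a b * S.fac v (0, a) * f (1, b)) • C (0, a) := by
  simp only [pair, Finset.mul_sum, Finset.sum_mul, Finset.smul_sum]
  rw [← Finset.sum_add_distrib, ← Finset.sum_add_distrib]
  refine Finset.sum_congr rfl fun a _ => ?_
  rw [← Finset.sum_add_distrib, ← Finset.sum_add_distrib]
  refine Finset.sum_congr rfl fun b _ => ?_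
  have h1 : O * (C (0, a) * C (1, b)) = f (0, a) • C (1, b) +
      (S.fac v (0, a) * f (1, b)) • C (0, a) +
      (S.fac v (0, a) * S.fac v (1, b)) • (C (0, a) * C (1, b) * O) := by
    rw [← mul_assoc, hO, add_mul, smul_mul_assoc, one_mul, smul_mul_assoc, mul_assoc, hO,
      mul_add, mul_smul_comm, mul_smul_comm, mul_one, mul_assoc]
    module
  rw [mul_smul_comm, h1, smul_mul_assoc]
  by_cases hg : S.g a b = 0
  · simp [hg]
  · rw [S.fac_pair v (S.deg_eq_of_g hg)]
    module

theorem mul_pair_zero {a : ι}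
    (hO : ∀ v', O * C v' = S.con (0, a) v' • 1 + S.fac (0, a) v' • (C v' * O)) :
    O * S.pair (fun a => C (0, a)) (fun b => C (1, b)) =
      (-S.eps) • (S.pair (fun a => C (0, a)) (fun b => C (1, b)) * O) + C (1, a) := by
  rw [S.mul_pair (0, a) hO]
  have h1 : ∀ b, ∑ c, S.g c b * S.con (0, a) (0, c) = if a = b then 1 else 0 := by
    intro b
    rw [← S.sum_ginv_g]
    exact Finset.sum_congr rfl fun c _ => by simp [con, mul_comm]
  rw [Finset.sum_comm]
  simp_rw [← Finset.sum_smul, h1]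
  simp [con]

theorem mul_pair_one {b : ι}
    (hO : ∀ v', O * C v' = S.con (1, b) v' • 1 + S.fac (1, b) v' • (C v' * O)) :
    O * S.pair (fun a => C (0, a)) (fun b => C (1, b)) =
      (-S.eps) • (S.pair (fun a => C (0, a)) (fun b => C (1, b)) * O) + S.eps • C (0, b) := by
  rw [S.mul_pair (1, b) hO]
  have h1 : ∀ a, ∑ c, S.g a c * S.fac (1, b) (0, a) * S.con (1, b) (1, c) =
      if a = b then S.eps else 0 := by
    intro a
    have h2 : ∀ c, S.g a c * S.fac (1, b) (0, a) * S.con (1, b) (1, c) =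
        S.eps * sgn (S.deg b) * sgn (S.deg b * S.deg a) * (S.g a c * S.g⁻¹ c b) := by
      intro c
      simp only [fac, con, if_true, Fin.one_eq_zero_iff, OfNat.ofNat_ne_one, if_false]
      rw [S.ginv_swap c b]
      by_cases h : S.g⁻¹ c b = 0
      · simp [h]
      · rw [S.deg_eq_of_ginv h]; ring
    simp_rw [h2, ← Finset.mul_sum, S.sum_g_ginv]
    split_ifs with hab
    · subst hab
      have h' : ∀ x : ZMod 2, x * x = x := by decide
      rw [h', mul_one, mul_assoc, sgn_mul_self, mul_one]
    · simp
  simp_rw [← Finset.sum_smul, h1]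
  simp [con]

end MulPair

theorem cre_zhat (v : Fin 2 × ι) : S.cre v * S.zhat = (-S.eps) • (S.zhat * S.cre v) := by
  rw [zhat, S.mul_pair v (f := 0) fun v' => by rw [cre_cre]; simp]
  simp

theorem ann_zero_zhat (a : ι) : S.ann (0, a) * S.zhat =
    (-S.eps) • (S.zhat * S.ann (0, a)) + S.cre (1, a) :=
  S.mul_pair_zero fun v' => S.ann_cre (0, a) v'

theorem ann_one_zhat (b : ι) : S.ann (1, b) * S.zhat =
    (-S.eps) • (S.zhat * S.ann (1, b)) + S.eps • S.cre (0, b) :=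
  S.mul_pair_one fun v' => S.ann_cre (1, b) v'

/-- Within one copy the creation operators have the graded symmetry opposite to that of the metric,
so the contraction equals its own negative. -/
theorem pair_cre_cre (j : Fin 2) : S.pair (fun a => S.cre (j, a)) (fun b => S.cre (j, b)) = 0 := by
  have h : S.pair (fun a => S.cre (j, a)) (fun b => S.cre (j, b)) =
      (-1 : ℂ) • S.pair (fun a => S.cre (j, a)) (fun b => S.cre (j, b)) := by
    conv_rhs => rw [← pair_swap]
    rw [pair, Finset.smul_sum]
    refine Finset.sum_congr rfl fun a _ => ?_
    rw [Finset.smul_sum]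
    refine Finset.sum_congr rfl fun b _ => ?_
    rw [S.cre_cre (j, a)]
    simp only [fac, if_true]
    module
  have h2 : (2 : ℂ) • S.pair (fun a => S.cre (j, a)) (fun b => S.cre (j, b)) = 0 := by
    rw [two_smul]; nth_rewrite 1 [h]; module
  exact (smul_eq_zero.mp h2).resolve_left two_ne_zero

theorem pair_cre_one_zero :
    S.eps • S.pair (fun a => S.cre (1, a)) (fun b => S.cre (0, b)) = S.zhat := by
  rw [zhat, ← pair_swap, pair, Finset.smul_sum]
  refine Finset.sum_congr rfl fun a _ => ?_
  rw [Finset.smul_sum]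
  refine Finset.sum_congr rfl fun b _ => ?_
  rw [S.cre_cre (1, b) (0, a)]
  simp only [fac, exch, Fin.one_eq_zero_iff, OfNat.ofNat_ne_one, if_false]
  rw [mul_comm (S.deg b)]
  have h1 := S.eps_mul_self
  have h2 := sgn_mul_self (S.deg a * S.deg b)
  match_scalars
  linear_combination S.g a b * sgn (S.deg a * S.deg b) ^ 2 * h1 + S.g a b * h2

section Commute

variable (f f' h h' : ι → Module.End ℂ S.Tensor)

theorem pair_add_left : S.pair (fun a => f a + h a) f' = S.pair f f' + S.pair h f' := by
  simp [pair, add_mul, Finset.sum_add_distrib]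

theorem pair_add_right : S.pair f (fun a => f' a + h' a) = S.pair f f' + S.pair f h' := by
  simp [pair, mul_add, Finset.sum_add_distrib]

theorem pair_smul_left (r : ℂ) : S.pair (fun a => r • f a) f' = r • S.pair f f' := by
  simp [pair, Finset.smul_sum, smul_comm r]

theorem pair_smul_right (r : ℂ) : S.pair f (fun a => r • f' a) = r • S.pair f f' := by
  simp [pair, Finset.smul_sum, smul_comm r]

/-- Commutation of a contraction with `zhat`. -/
theorem pair_mul_zhat (hf : ∀ a, f a * S.zhat = (-S.eps) • (S.zhat * f a) + h a)
    (hf' : ∀ a, f' a * S.zhat = (-S.eps) • (S.zhat * f' a) + h' a) :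
    S.pair f f' * S.zhat =
      S.zhat * S.pair f f' + (-S.eps) • S.pair h f' + S.pair f h' := by
  simp only [pair, Finset.sum_mul, Finset.mul_sum, Finset.smul_sum]
  rw [← Finset.sum_add_distrib, ← Finset.sum_add_distrib]
  refine Finset.sum_congr rfl fun a _ => ?_
  rw [← Finset.sum_add_distrib, ← Finset.sum_add_distrib]
  refine Finset.sum_congr rfl fun b _ => ?_
  rw [smul_mul_assoc, mul_assoc, hf', mul_add, mul_smul_comm, ← mul_assoc, hf, add_mul,
    smul_mul_assoc, mul_assoc, mul_smul_comm]
  have h2 := S.eps_mul_self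
  match_scalars
  · linear_combination S.g a b * h2
  · ring
  · ring

end Commute

/-- The number operators. -/
def numOp (j : Fin 2) : Module.End ℂ S.Tensor :=
  S.pair (fun a => S.cre (j, a)) fun b => S.ann (j, b)

theorem numOp_zhat (j : Fin 2) : S.numOp j * S.zhat = S.zhat * S.numOp j + S.zhat := by
  have h0 : ∀ v, S.cre v * S.zhat = (-S.eps) • (S.zhat * S.cre v) + 0 := fun v => by
    rw [cre_zhat, add_zero]
  match j with
  | 0 =>
    refine (S.pair_mul_zhat _ _ _ _ (fun a => h0 _) fun b => S.ann_zero_zhat b).trans ?_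
    simp [pair, numOp, zhat]
  | 1 =>
    refine (S.pair_mul_zhat _ _ _ _ (fun a => h0 _) fun b => S.ann_one_zhat b).trans ?_
    rw [pair_smul_right, pair_cre_one_zero]
    simp [pair, numOp]

/-- The correction term is a contraction of two creation operators in the same copy, which is zero.
Hence the mixed operator, which kills 1, kills every power of `zhat`. -/
theorem pair_cre_ann_zhat :
    S.pair (fun a => S.cre (0, a)) (fun b => S.ann (1, b)) * S.zhat =
      S.zhat * S.pair (fun a => S.cre (0, a)) fun b => S.ann (1, b) := by
  have h0 : ∀ v, S.cre v * S.zhat = (-S.eps) • (S.zhat * S.cre v) + 0 := fun v => by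
    rw [cre_zhat, add_zero]
  refine (S.pair_mul_zhat _ _ _ _ (fun a => h0 _) fun b => S.ann_one_zhat b).trans ?_
  rw [pair_smul_right, pair_cre_cre]
  simp [pair]

theorem pair_ann_cre_zhat :
    S.pair (fun a => S.ann (0, a)) (fun b => S.cre (1, b)) * S.zhat =
      S.zhat * S.pair (fun a => S.ann (0, a)) fun b => S.cre (1, b) := by
  have h0 : ∀ v, S.cre v * S.zhat = (-S.eps) • (S.zhat * S.cre v) + 0 := fun v => by
    rw [cre_zhat, add_zero]
  refine (S.pair_mul_zhat _ _ _ _ (fun a => S.ann_zero_zhat a) fun b => h0 _).trans ?_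
  rw [pair_cre_cre]
  simp [pair]

/-- Reversing the indices of the inverse metric inserts `ϵ` and a parity sign, which turns the trace
of the identity into a supertrace. -/
theorem eps_sum_g_ginv : ∑ a, ∑ b, S.g a b * S.g⁻¹ a b = S.omega := by
  have h1 : ∀ a b, S.g a b * S.g⁻¹ a b = S.eps * sgn (S.deg a) * (S.g a b * S.g⁻¹ b a) := by
    intro a b
    rw [S.ginv_swap b a]
    by_cases h : S.g⁻¹ b a = 0
    · simp [h]
    · rw [S.deg_eq_of_ginv h]; ring
  simp_rw [h1, ← Finset.mul_sum, S.sum_g_ginv, if_true, mul_one, omega, ← Finset.mul_sum]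
  congr 1
  have h2 : ∀ a, sgn (S.deg a) =
      (if S.deg a = 0 then (1 : ℂ) else 0) - if S.deg a = 1 then 1 else 0 := by
    intro a
    rcases S.deg_cases a with h | h <;> simp [h, sgn_zero, sgn_one]
  simp_rw [h2]
  rw [Finset.sum_sub_distrib, Finset.sum_boole, Finset.sum_boole]

/-- The double contraction. -/
def lapl : Module.End ℂ S.Tensor := S.pair (fun a => S.ann (0, a)) fun b => S.ann (1, b)

theorem pair_ann_cre : S.pair (fun a => S.ann (0, a)) (fun b => S.cre (0, b)) =
    S.omega • 1 + (-1 : ℂ) • S.numOp 0 := by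
  rw [numOp, ← S.pair_swap (fun a => S.cre (0, a)), pair, ← eps_sum_g_ginv, Finset.sum_smul, Finset.smul_sum,
    ← Finset.sum_add_distrib]
  refine Finset.sum_congr rfl fun a _ => ?_
  rw [Finset.sum_smul, Finset.smul_sum, ← Finset.sum_add_distrib]
  refine Finset.sum_congr rfl fun b _ => ?_
  rw [ann_cre]
  simp only [con, fac, if_true]
  module

theorem lapl_zhat : S.lapl * S.zhat = S.zhat * S.lapl + (S.eps * S.omega) • 1 +
    (-S.eps) • (S.numOp 0 + S.numOp 1) := by
  refine (S.pair_mul_zhat _ _ _ _ (fun a => S.ann_zero_zhat a) fun b => S.ann_one_zhat b).trans ?_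
  rw [pair_smul_right, pair_ann_cre]
  simp only [lapl, numOp]
  module

/-- The first invariant `ε_{ab} c_1^a c_2^b`. -/
def z : S.Tensor := S.pair (fun a => S.osc (0, a)) fun b => S.osc (1, b)

/-- Obtained from `lop = cre + ½ ann` in both factors. On powers of `zhat` the mixed terms vanish,
so only raising by `zhat` and lowering by `lapl` remain. -/
theorem mulLeft_z : LinearMap.mulLeft ℂ S.z = S.zhat +
    (1 / 2 : ℂ) • (S.pair (fun a => S.ann (0, a)) (fun b => S.cre (1, b)) +
      S.pair (fun a => S.cre (0, a)) fun b => S.ann (1, b)) + (1 / 4 : ℂ) • S.lapl := by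
  have h : LinearMap.mulLeft ℂ S.z = S.pair (fun a => S.lop (0, a)) fun b => S.lop (1, b) := by
    ext t
    simp only [z, pair, LinearMap.mulLeft_apply, Finset.sum_mul, LinearMap.sum_apply,
      LinearMap.smul_apply, Module.End.mul_apply, lop_apply, smul_mul_assoc, mul_assoc]
  rw [h, funext fun a => S.lop_eq (0, a), funext fun a => S.lop_eq (1, a), pair_add_left,
    pair_add_right, pair_add_right, pair_smul_left, pair_smul_left, pair_smul_right,
    pair_smul_right, zhat, lapl]
  module

/-- The powers of `zhat`, applied to `1`. -/
def zpow (k : ℕ) : S.Tensor := (S.zhat ^ k) 1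

theorem zpow_zero : S.zpow 0 = 1 := by simp [zpow]

theorem zpow_succ (k : ℕ) : S.zpow (k + 1) = S.zhat (S.zpow k) := by
  rw [zpow, pow_succ']; rfl

theorem pair_ann_one (f : ι → Module.End ℂ S.Tensor) (j : Fin 2) :
    S.pair f (fun b => S.ann (j, b)) 1 = 0 := by
  simp [pair, LinearMap.sum_apply, ann_one]

theorem numOp_zpow (j : Fin 2) (k : ℕ) : S.numOp j (S.zpow k) = (k : ℂ) • S.zpow k := by
  induction k with
  | zero => rw [zpow_zero, numOp, pair_ann_one]; simp
  | succ k ih =>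
    have h := LinearMap.congr_fun (S.numOp_zhat j) (S.zpow k)
    simp only [Module.End.mul_apply, LinearMap.add_apply] at h
    rw [zpow_succ, h, ih, map_smul]
    push_cast
    module

theorem pair_cre_ann_zpow (k : ℕ) :
    S.pair (fun a => S.cre (0, a)) (fun b => S.ann (1, b)) (S.zpow k) = 0 := by
  induction k with
  | zero => rw [zpow_zero, pair_ann_one]
  | succ k ih =>
    have h := LinearMap.congr_fun S.pair_cre_ann_zhat (S.zpow k)
    simp only [Module.End.mul_apply] at h
    rw [zpow_succ, h, ih, map_zero]

theorem pair_ann_cre_zpow (k : ℕ) :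
    S.pair (fun a => S.ann (0, a)) (fun b => S.cre (1, b)) (S.zpow k) = 0 := by
  induction k with
  | zero =>
    rw [zpow_zero]
    have h : ∀ a b, (S.ann (0, a) * S.cre (1, b)) 1 = 0 := by
      intro a b
      rw [ann_cre]
      simp [con, ann_one]
    simp [pair, LinearMap.sum_apply, h, -Module.End.mul_apply]
  | succ k ih =>
    have h := LinearMap.congr_fun S.pair_ann_cre_zhat (S.zpow k)
    simp only [Module.End.mul_apply] at h
    rw [zpow_succ, h, ih, map_zero]

theorem lapl_zpow (k : ℕ) :
    S.lapl (S.zpow (k + 1)) = (S.eps * (k + 1) * (S.omega - k)) • S.zpow k := by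
  have h := fun k => LinearMap.congr_fun S.lapl_zhat (S.zpow k)
  simp only [Module.End.mul_apply, LinearMap.add_apply, LinearMap.smul_apply,
    Module.End.one_apply, numOp_zpow, ← zpow_succ] at h
  induction k with
  | zero =>
    rw [h, zpow_zero, lapl, pair_ann_one, map_zero]
    push_cast
    module
  | succ k ih =>
    rw [h, ih, map_smul, ← zpow_succ]
    push_cast
    module

/-- The divided powers `zhat^k / k!`, applied to `1`. -/
def divPow (k : ℕ) : S.Tensor := (k.factorial : ℂ)⁻¹ • S.zpow k

theorem divPow_zero : S.divPow 0 = 1 := by simp [divPow, zpow_zero]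

theorem factorial_inv_succ (k : ℕ) :
    ((k + 1 : ℕ) : ℂ) * (((k + 1).factorial : ℕ) : ℂ)⁻¹ = (k.factorial : ℂ)⁻¹ := by
  have h1 : ((k + 1 : ℕ) : ℂ) ≠ 0 := by exact_mod_cast k.succ_ne_zero
  have h2 : (k.factorial : ℂ) ≠ 0 := by exact_mod_cast k.factorial_ne_zero
  rw [Nat.factorial_succ, Nat.cast_mul]
  field_simp

theorem z_eq_divPow_one : S.z = S.divPow 1 := by
  have h := LinearMap.congr_fun S.mulLeft_z 1
  have h1 := S.pair_ann_cre_zpow 0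
  have h2 := S.pair_cre_ann_zpow 0
  rw [zpow_zero] at h1 h2
  simp only [LinearMap.mulLeft_apply, mul_one, LinearMap.add_apply, LinearMap.smul_apply, h1, h2,
    lapl, pair_ann_one, add_zero, smul_zero] at h
  rw [h]
  simp [divPow, zpow]

theorem z_mul_divPow (k : ℕ) : S.z * S.divPow (k + 1) =
    ((k : ℂ) + 2) • S.divPow (k + 2) + (S.eps * (S.omega - k) / 4) • S.divPow k := by
  have h := LinearMap.congr_fun S.mulLeft_z (S.zpow (k + 1))
  simp only [LinearMap.mulLeft_apply, LinearMap.add_apply, LinearMap.smul_apply,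
    pair_ann_cre_zpow, pair_cre_ann_zpow, lapl_zpow, add_zero, smul_zero, ← zpow_succ] at h
  have h1 := factorial_inv_succ k
  have h2 := factorial_inv_succ (k + 1)
  push_cast at h1 h2
  rw [divPow, mul_smul_comm, h, divPow, divPow]
  match_scalars
  · linear_combination -h2
  · linear_combination (S.eps * (S.omega - k) / 4) * h1

/-- The recurrence can be solved for `divPow (k + 2)` because `k + 2 ≠ 0`; each divided power is
thus a polynomial in `z`. -/
theorem divPow_comm {t : S.Tensor} (ht : S.z * t = t * S.z) (k : ℕ) :
    S.divPow k * t = t * S.divPow k := by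
  induction k using Nat.strong_induction_on with
  | _ k ih =>
    match k with
    | 0 => rw [divPow_zero, one_mul, mul_one]
    | 1 => rw [← z_eq_divPow_one, ht]
    | k + 2 =>
      have h1 := S.z_mul_divPow k
      have hk : ((k : ℂ) + 2) ≠ 0 := by exact_mod_cast (k + 1).succ_ne_zero
      have h2 : S.divPow (k + 2) = ((k : ℂ) + 2)⁻¹ • (S.z * S.divPow (k + 1) +
          (-(S.eps * (S.omega - k) / 4)) • S.divPow k) := by
        rw [h1, eq_inv_smul_iff₀ hk]; module
      rw [h2, mul_smul_comm, smul_mul_assoc, mul_add, add_mul, mul_smul_comm, smul_mul_assoc,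
        ih k (by omega), mul_assoc, ih (k + 1) (by omega), ← mul_assoc, ht, mul_assoc]

/-! ### The invariants -/

theorem ann_creWord {v : Fin 2 × ι} {j : Fin 2} (h : v.1 ≠ j) {k : ℕ} (a : Fin k → ι) :
    S.ann v (S.creWord j a) = 0 := by
  induction k with
  | zero => rw [creWord_zero, ann_one]
  | succ k ih =>
    have h1 := LinearMap.congr_fun (S.ann_cre v (j, a 0)) (S.creWord j fun i => a i.succ)
    simp only [Module.End.mul_apply, LinearMap.add_apply, LinearMap.smul_apply,
      LinearMap.zero_apply, ih, map_zero, smul_zero, con, h, if_false, zero_smul, add_zero] at h1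
    rw [creWord_succ, h1]

theorem creWord_mul {j : Fin 2} {t : S.Tensor} (h : ∀ a, S.ann (j, a) t = 0) {k : ℕ}
    (a : Fin k → ι) : S.creWord j a * t = S.creOp j a t := by
  induction k with
  | zero => simp [creWord_zero, creOp]
  | succ k ih =>
    rw [creWord_succ, ← S.cre_mul _ (h _), ih, creOp_succ]; rfl

theorem cre_zhat_pow (v : Fin 2 × ι) (k : ℕ) :
    S.cre v * S.zhat ^ k = (-S.eps) ^ k • (S.zhat ^ k * S.cre v) := by
  induction k with
  | zero => simp
  | succ k ih =>
    rw [pow_succ, ← mul_assoc, ih, smul_mul_assoc, mul_assoc, cre_zhat, mul_smul_comm, smul_smul,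
      ← pow_succ, mul_assoc]

/-- The reversed order of the second word nests the contractions. Carrying the outermost creation
operator of copy 0 through the inner `zhat ^ k` costs `(-ϵ)^k`, and these exponents add up to
`k.choose 2`. -/
theorem sum_creOp (k : ℕ) : ∑ a : Fin k → ι, ∑ b : Fin k → ι, (∏ i, S.g (a i) (b i)) •
    (S.creOp 0 a * S.creOp 1 fun i => b i.rev) = (-S.eps) ^ k.choose 2 • S.zhat ^ k := by
  induction k with
  | zero => simp [creOp]
  | succ k ih =>
    have hlast : ∀ b : Fin (k + 1) → ι, (S.creOp 1 fun i => b i.rev) =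
        (S.creOp 1 fun i => b i.rev.succ) * S.cre (1, b 0) := by
      intro b
      simp only [creOp]
      rw [List.ofFn_succ', List.concat_eq_append, List.prod_append, List.prod_singleton]
      simp [Fin.rev_castSucc]
    have hterm : ∀ (x y : ι) (a b : Fin k → ι),
        (∏ i, S.g ((Fin.cons x a : Fin (k + 1) → ι) i) ((Fin.cons y b : Fin (k + 1) → ι) i)) •
          (S.creOp 0 (Fin.cons x a) * S.creOp 1 fun i => (Fin.cons y b : Fin (k + 1) → ι) i.rev) =
        S.g x y • (S.cre (0, x) * ((∏ i, S.g (a i) (b i)) •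
          (S.creOp 0 a * S.creOp 1 fun i => b i.rev)) * S.cre (1, y)) := by
      intro x y a b
      rw [hlast, creOp_succ, Fin.prod_univ_succ]
      simp only [Fin.cons_zero, Fin.cons_succ, mul_smul_comm, smul_mul_assoc, smul_smul, mul_assoc]
    rw [sum_cons]
    have hx : ∀ x : ι, ∑ a : Fin k → ι, ∑ b : Fin (k + 1) → ι,
        (∏ i, S.g ((Fin.cons x a : Fin (k + 1) → ι) i) (b i)) •
          (S.creOp 0 (Fin.cons x a) * S.creOp 1 fun i => b i.rev) =
        ∑ y, S.g x y • (S.cre (0, x) * ((-S.eps) ^ k.choose 2 • S.zhat ^ k) * S.cre (1, y)) := by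
      intro x
      simp_rw [sum_cons (ι := ι) (k := k), hterm]
      rw [Finset.sum_comm]
      refine Finset.sum_congr rfl fun y _ => ?_
      simp_rw [← Finset.smul_sum, ← Finset.sum_mul, ← Finset.mul_sum, ih]
    simp_rw [hx, mul_smul_comm, cre_zhat_pow, smul_mul_assoc, mul_assoc]
    have hc : (k + 1).choose 2 = k.choose 2 + k := by
      rw [Nat.choose_succ_succ, Nat.choose_one_right, add_comm]
    rw [pow_succ S.zhat, zhat, pair, hc, pow_add]
    simp_rw [Finset.mul_sum, Finset.smul_sum, mul_smul_comm, smul_smul]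
    refine Finset.sum_congr rfl fun x _ => Finset.sum_congr rfl fun y _ => ?_
    congr 1
    ring

theorem invariant_eq (k : ℕ) :
    S.invariant k = ((-S.eps) ^ k.choose 2 * k.factorial) • S.divPow k := by
  have h := LinearMap.congr_fun (S.sum_creOp k) 1
  simp only [LinearMap.sum_apply, LinearMap.smul_apply, Module.End.mul_apply] at h
  rw [divPow, smul_smul, mul_assoc, mul_inv_cancel₀ (by exact_mod_cast k.factorial_ne_zero),
    mul_one, zpow, ← h, invariant]
  refine Finset.sum_congr rfl fun a _ => Finset.sum_congr rfl fun b _ => ?_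
  rw [inOsc_symProd, inOsc_symProd, S.creWord_mul fun a => S.ann_creWord (by simp) _]
  rfl

end SuperMetric

/-! ### The functional equation of the R-operator -/

section Core

variable {B : Type*} [Ring B] [Algebra ℂ B]

/-- If `y e_k` is given by a three-term recurrence and `P` shifts `y` by two, then
anticommutators with `P` are expressed by commutators. -/
theorem anticomm_eq_of_shift {y P : B} {e : ℕ → B} {ω : ℂ} (he0 : e 0 = 1) (he1 : y = e 1)
    (he : ∀ k : ℕ, y * e (k + 1) = ((k : ℂ) + 2) • e (k + 2) + ((ω - k) / 4) • e k)
    (hc : ∀ k, y * e k = e k * y) (hP : y * P = P * y + (2 : ℂ) • P) (k : ℕ) :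
    (e (k + 1) * P + P * e (k + 1) =
      (e (k + 2) * P - P * e (k + 2)) + (1 / 4 : ℂ) • (e k * P - P * e k)) ∧
    (e (k + 1) * P - P * e (k + 1)) * (y + 1) =
      ((k : ℂ) + 1) • (e (k + 2) * P - P * e (k + 2)) +
        ((ω - (k + 1)) / 4) • (e k * P - P * e k) := by
  have hmul : ∀ k : ℕ, e (k + 1) * P * y = ((k : ℂ) + 2) • (e (k + 2) * P) +
      ((ω - k) / 4) • (e k * P) - (2 : ℂ) • (e (k + 1) * P) := by
    intro k
    have h : y * (e (k + 1) * P) = e (k + 1) * P * y + (2 : ℂ) • (e (k + 1) * P) := by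
      rw [← mul_assoc, hc, mul_assoc, hP, mul_add, mul_smul_comm, mul_assoc]
    rw [eq_sub_iff_add_eq, ← h, ← mul_assoc, he, add_mul, smul_mul_assoc, smul_mul_assoc]
  have hmul' : ∀ k : ℕ, P * e (k + 1) * y = ((k : ℂ) + 2) • (P * e (k + 2)) +
      ((ω - k) / 4) • (P * e k) := by
    intro k
    rw [mul_assoc, ← hc, he, mul_add, mul_smul_comm, mul_smul_comm]
  have hC : ∀ k : ℕ, (e (k + 1) * P - P * e (k + 1)) * (y + 1) =
      ((k : ℂ) + 2) • (e (k + 2) * P - P * e (k + 2)) + ((ω - k) / 4) • (e k * P - P * e k) -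
        (e (k + 1) * P + P * e (k + 1)) := by
    intro k
    rw [mul_add, mul_one, sub_mul, hmul, hmul']
    module
  have hT : ∀ k : ℕ, (e (k + 1) * P + P * e (k + 1)) * (y + 1) =
      ((k : ℂ) + 2) • (e (k + 2) * P + P * e (k + 2)) + ((ω - k) / 4) • (e k * P + P * e k) -
        (e (k + 1) * P - P * e (k + 1)) := by
    intro k
    rw [mul_add, mul_one, add_mul, hmul, hmul']
    module
  have h1P : e 1 * P = P * e 1 + (2 : ℂ) • P := by rw [← he1, hP]
  suffices hmain : e (k + 1) * P + P * e (k + 1) =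
      (e (k + 2) * P - P * e (k + 2)) + (1 / 4 : ℂ) • (e k * P - P * e k) by
    refine ⟨hmain, ?_⟩
    rw [hC, hmain]
    module
  have h2 : ∀ x z : B, (2 : ℂ) • x = (2 : ℂ) • z → x = z :=
    fun x z h => smul_right_injective B (two_ne_zero (α := ℂ)) h
  -- The induction needs both identities at the previous index. The element `b` stands for a quarter
  -- of the commutator of `e (k - 1)` with P and is 0 when `k = 0`, which avoids a negative index.
  suffices haux : (∃ b, e k * P + P * e k = (e (k + 1) * P - P * e (k + 1)) + b ∧
      (e k * P - P * e k) * (y + 1) =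
        (k : ℂ) • (e (k + 1) * P - P * e (k + 1)) + (ω - k) • b) ∧
      e (k + 1) * P + P * e (k + 1) =
        (e (k + 2) * P - P * e (k + 2)) + (1 / 4 : ℂ) • (e k * P - P * e k) from haux.2
  induction k with
  | zero =>
    simp only [zero_add, he0, one_mul, mul_one, Nat.cast_zero]
    refine ⟨⟨0, ?_, ?_⟩, ?_⟩
    · rw [h1P]; module
    · rw [sub_self, zero_mul]; module
    · have h3 := hC 0
      have h4 : (e 1 * P - P * e 1) * (y + 1) = e 1 * P + P * e 1 := by
        rw [h1P, mul_add, mul_one, add_sub_cancel_left, smul_mul_assoc, he1]; module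
      simp only [zero_add, he0, one_mul, mul_one, Nat.cast_zero] at h3
      rw [h4] at h3
      apply h2
      linear_combination (norm := module) h3
  | succ k ih =>
    obtain ⟨⟨b, hb1, hb2⟩, hm⟩ := ih
    refine ⟨⟨_, hm, ?_⟩, ?_⟩
    · rw [hC, hm]
      push_cast
      module
    · have h3 := hT k
      rw [hm, add_mul, smul_mul_assoc, hb2, hb1, hC (k + 1)] at h3
      have hk : ((k : ℂ) + 3) ≠ 0 := by exact_mod_cast (k + 2).succ_ne_zero
      apply smul_right_injective B hk
      push_cast at h3 ⊢
      linear_combination (norm := module) (-1 : ℂ) • h3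

/-- The functional equation of the R-operator, truncated. -/
theorem sum_functional_equation {y P : B} {e : ℕ → B} {ω u : ℂ} {ρ : ℕ → ℂ} (he0 : e 0 = 1)
    (he1 : y = e 1)
    (he : ∀ k : ℕ, y * e (k + 1) = ((k : ℂ) + 2) • e (k + 2) + ((ω - k) / 4) • e k)
    (hc : ∀ k, y * e k = e k * y) (hP : y * P = P * y + (2 : ℂ) • P)
    (hρ : ∀ k : ℕ, (k + 2 + u - ω) * ρ (k + 2) = 4 * (k - u) * ρ k) (K : ℕ) :
    ∑ k ∈ Finset.range (K + 2), ρ k • ((-u) • (e k * P + P * e k) +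
      (e k * P - P * e k) * (y + 1)) =
    ((K - u) * ρ K) • (e (K + 1) * P - P * e (K + 1)) +
      ((K + 1 - u) * ρ (K + 1)) • (e (K + 2) * P - P * e (K + 2)) := by
  have key := anticomm_eq_of_shift he0 he1 he hc hP
  induction K with
  | zero =>
    have h1P : P * e 1 = e 1 * P - (2 : ℂ) • P := by rw [← he1, hP]; module
    rw [Finset.sum_range_succ, Finset.sum_range_succ, Finset.sum_range_zero, (key 0).1,
      (key 0).2]
    simp only [zero_add, he0, one_mul, mul_one, Nat.cast_zero, sub_self, zero_mul, h1P]
    module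
  | succ K ih =>
    rw [Finset.sum_range_succ, ih, (key (K + 1)).1, (key (K + 1)).2]
    -- The commutator of `e (K + 1)` with P receives contributions from the terms `K` and `K + 2`;
    -- the recurrence says exactly that they cancel.
    have h := hρ K
    push_cast
    linear_combination (norm := module)
      ((-1 / 4 : ℂ) * h) • (e (K + 1) * P - P * e (K + 1))

/-- The truncated functional equation for an eigenvector `P` of the commutator with `z`. -/
theorem sum_eigenvector_mem {z P : B} {E : ℕ → B} {ω u ϵ s : ℂ} {c : ℕ → ℂ} (hϵ : ϵ * ϵ = 1)
    (hs : s * s = ϵ) (hE0 : E 0 = 1) (hE1 : z = E 1)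
    (hE : ∀ k : ℕ, z * E (k + 1) = ((k : ℂ) + 2) • E (k + 2) + (ϵ * (ω - k) / 4) • E k)
    (hc : ∀ k, z * E k = E k * z) (hP : z * P = P * z + (2 * s) • P)
    (hr : ∀ k : ℕ, (k + 2 + u - ω) * c (k + 2) = 4 * ϵ * (k - u) * c k) {K : ℕ}
    {N : Submodule ℂ B} (hN : ∀ k, K < k → E k * P ∈ N ∧ P * E k ∈ N) :
    ∑ k ∈ Finset.range (K + 2), c k • ((-u) • (E k * P + P * E k) +
      (E k * P - P * E k) * (s⁻¹ • z + 1)) ∈ N := by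
  have hs0 : s ≠ 0 := by rintro rfl; rw [← hs] at hϵ; simp at hϵ
  have hs2 : s⁻¹ * s = 1 := inv_mul_cancel₀ hs0
  have hsϵ : s⁻¹ * s⁻¹ * ϵ = 1 := by rw [← hs]; field_simp
  -- Rescaling `E k` by `s⁻¹ ^ k` removes `ϵ` from the three-term recurrence and normalizes the
  -- shift of `y` by P to 2.
  have h := sum_functional_equation (y := s⁻¹ • z) (P := P) (e := fun k => s⁻¹ ^ k • E k) (ω := ω)
    (u := u) (ρ := fun k => c k * s ^ k) (by simp [hE0]) (by simp [← hE1])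
    (fun k => by
      rw [smul_mul_smul_comm, hE]
      match_scalars
      · ring
      · linear_combination (s⁻¹ ^ k * (ω - k) / 4) * hsϵ)
    (fun k => by rw [smul_mul_smul_comm, smul_mul_smul_comm, hc, mul_comm])
    (by
      rw [smul_mul_assoc, hP, mul_smul_comm]
      match_scalars
      · ring
      · linear_combination 2 * hs2)
    (fun k => by linear_combination s ^ (k + 2) * hr k - 4 * (u - k) * c k * s ^ k * ϵ * hs
        - 4 * (u - k) * c k * s ^ k * hϵ) K
  have h' : ∑ k ∈ Finset.range (K + 2), c k • ((-u) • (E k * P + P * E k) +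
      (E k * P - P * E k) * (s⁻¹ • z + 1)) = ∑ k ∈ Finset.range (K + 2), (c k * s ^ k) •
        ((-u) • ((s⁻¹ ^ k • E k) * P + P * (s⁻¹ ^ k • E k)) +
      ((s⁻¹ ^ k • E k) * P - P * (s⁻¹ ^ k • E k)) * (s⁻¹ • z + 1)) := by
    refine Finset.sum_congr rfl fun k _ => ?_
    have hk : c k = c k * s ^ k * s⁻¹ ^ k := by
      rw [mul_assoc, ← mul_pow, mul_inv_cancel₀ hs0, one_pow, mul_one]
    conv_lhs => rw [hk, mul_smul]
    congr 1
    rw [smul_mul_assoc, mul_smul_comm, ← smul_add, ← smul_sub, smul_mul_assoc, smul_add,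
      smul_comm (-u)]
  rw [h', h]
  refine N.add_mem (N.smul_mem _ ?_) (N.smul_mem _ ?_) <;>
  · simp only [smul_mul_assoc, mul_smul_comm]
    exact N.sub_mem (N.smul_mem _ (hN _ (by omega)).1) (N.smul_mem _ (hN _ (by omega)).2)

/-- The truncated spinorial RLL-relation in an algebra generated by `X_j`, `D_j`. -/
theorem rll_mem {X₀ X₁ D₀ D₁ z h : B} {E : ℕ → B} {ω u v ϵ : ℂ} {c : ℕ → ℂ} (hϵ : ϵ * ϵ = 1)
    (hX₀ : z * X₀ = ϵ • X₁ - ϵ • (X₀ * z)) (hX₁ : z * X₁ = X₀ - ϵ • (X₁ * z))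
    (hD₀ : z * D₀ = ϵ • D₁ - ϵ • (D₀ * z)) (hD₁ : z * D₁ = D₀ - ϵ • (D₁ * z))
    (hX : X₀ * X₀ = X₁ * X₁) (hD : D₀ * D₀ = D₁ * D₁) (hDX : D₀ * X₁ = ϵ • (X₁ * D₀) + z)
    (hh : h * (X₀ * D₀) = X₀ * D₀ * h) (hz : z * h = h * z)
    (hE0 : E 0 = 1) (hE1 : z = E 1)
    (hE : ∀ k : ℕ, z * E (k + 1) = ((k : ℂ) + 2) • E (k + 2) + (ϵ * (ω - k) / 4) • E k)
    (hEz : ∀ k t, z * t = t * z → E k * t = t * E k)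
    (hr : ∀ k : ℕ, (k + 2 + u - ω) * c (k + 2) = 4 * ϵ * (k - u) * c k) {K : ℕ}
    {N : Submodule ℂ B}
    (hN : ∀ t ∈ [X₀ * D₀, X₁ * D₁, X₀ * D₁, X₁ * D₀], ∀ k, K < k → E k * t ∈ N ∧ t * E k ∈ N)
    {R : B} (hR : R = ∑ k ∈ Finset.range (K + 2), c k • E k) :
    R * ((u + v) • 1 + X₀ * D₀ - (1 / 2 : ℂ) • h) * (v • 1 + X₁ * D₁ - (1 / 2 : ℂ) • h) -
      (v • 1 + X₀ * D₀ - (1 / 2 : ℂ) • h) * ((u + v) • 1 + X₁ * D₁ - (1 / 2 : ℂ) • h) * R ∈ N := by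
  have h00 : z * (X₀ * D₀) = X₀ * D₀ * z + (ϵ • (X₁ * D₀) - X₀ * D₁) := by
    rw [← mul_assoc, hX₀, sub_mul, smul_mul_assoc, smul_mul_assoc, mul_assoc, hD₀, mul_sub,
      mul_smul_comm, mul_smul_comm, mul_assoc]
    linear_combination (norm := module) hϵ • (X₀ * (D₀ * z)) - hϵ • (X₀ * D₁)
  have h11 : z * (X₁ * D₁) = X₁ * D₁ * z - (ϵ • (X₁ * D₀) - X₀ * D₁) := by
    rw [← mul_assoc, hX₁, sub_mul, smul_mul_assoc, mul_assoc, hD₁, mul_sub,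
      mul_smul_comm, mul_assoc]
    linear_combination (norm := module) hϵ • (X₁ * (D₁ * z))
  have h01 : z * (X₀ * D₁) = X₀ * D₁ * z + ϵ • (X₁ * D₁ - X₀ * D₀) := by
    rw [← mul_assoc, hX₀, sub_mul, smul_mul_assoc, smul_mul_assoc, mul_assoc, hD₁, mul_sub,
      mul_smul_comm, mul_assoc]
    linear_combination (norm := module) hϵ • (X₀ * (D₁ * z))
  have h10 : z * (X₁ * D₀) = X₁ * D₀ * z + (X₀ * D₀ - X₁ * D₁) := by
    rw [← mul_assoc, hX₁, sub_mul, smul_mul_assoc, mul_assoc, hD₀, mul_sub,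
      mul_smul_comm, mul_smul_comm, mul_assoc]
    linear_combination (norm := module) hϵ • (X₁ * (D₀ * z)) - hϵ • (X₁ * D₁)
  have hXX : z * (X₀ * X₁) = X₀ * X₁ * z := by
    rw [← mul_assoc, hX₀, sub_mul, smul_mul_assoc, smul_mul_assoc, mul_assoc, hX₁, mul_sub,
      mul_smul_comm, mul_assoc, hX]
    linear_combination (norm := module) hϵ • (X₀ * (X₁ * z))
  have hDD : z * (D₀ * D₁) = D₀ * D₁ * z := by
    rw [← mul_assoc, hD₀, sub_mul, smul_mul_assoc, smul_mul_assoc, mul_assoc, hD₁, mul_sub,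
      mul_smul_comm, mul_assoc, hD]
    linear_combination (norm := module) hϵ • (D₀ * (D₁ * z))
  -- The four products `X_i D_j` split under the commutator with `z`: `Y` and `Y'` are invariant,
  -- while `b` and `d` are exchanged up to factors.
  obtain ⟨Y, hY⟩ : ∃ Y, Y = X₀ * D₀ + X₁ * D₁ := ⟨_, rfl⟩
  obtain ⟨Y', hY'⟩ : ∃ Y', Y' = X₀ * D₁ + ϵ • (X₁ * D₀) := ⟨_, rfl⟩
  obtain ⟨b, hb⟩ : ∃ b, b = X₀ * D₀ - X₁ * D₁ := ⟨_, rfl⟩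
  obtain ⟨d, hd⟩ : ∃ d, d = ϵ • (X₁ * D₀) - X₀ * D₁ := ⟨_, rfl⟩
  have hzb : z * b = b * z + (2 : ℂ) • d := by
    rw [hb, mul_sub, sub_mul, h00, h11, hd]; module
  have hzd : z * d = d * z + (2 * ϵ) • b := by
    rw [hd, hb, mul_sub, sub_mul, mul_smul_comm, h10, h01, smul_mul_assoc]; module
  have hzY : z * Y = Y * z := by rw [hY, mul_add, add_mul, h00, h11]; module
  have hzY' : z * Y' = Y' * z := by
    rw [hY', mul_add, add_mul, mul_smul_comm, h01, h10, smul_mul_assoc]; module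
  have hmem : ∀ s : ℂ, s * s = ϵ → ∑ k ∈ Finset.range (K + 2), c k •
      ((-u) • (E k * (d + s • b) + (d + s • b) * E k) +
        (E k * (d + s • b) - (d + s • b) * E k) * (s⁻¹ • z + 1)) ∈ N := by
    intro s hs
    refine sum_eigenvector_mem hϵ hs hE0 hE1 hE (fun k => (hEz k z rfl).symm) ?_ hr ?_
    · rw [mul_add, mul_smul_comm, hzd, hzb, add_mul, smul_mul_assoc]
      linear_combination (norm := module) (-2 * hs) • b
    · intro k hk
      simp only [List.mem_cons, List.not_mem_nil, or_false, forall_eq_or_imp, forall_eq] at hN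
      obtain ⟨n1, n2, n3, n4⟩ := hN
      rw [hd, hb]
      simp only [mul_add, add_mul, mul_sub, sub_mul, mul_smul_comm, smul_mul_assoc]
      exact ⟨N.add_mem (N.sub_mem (N.smul_mem _ (n4 k hk).1) (n3 k hk).1)
          (N.smul_mem _ (N.sub_mem (n1 k hk).1 (n2 k hk).1)),
        N.add_mem (N.sub_mem (N.smul_mem _ (n4 k hk).2) (n3 k hk).2)
          (N.smul_mem _ (N.sub_mem (n1 k hk).2 (n2 k hk).2))⟩
  have hRz : ∀ t, z * t = t * z → R * t = t * R := by
    intro t ht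
    rw [hR, Finset.sum_mul, Finset.mul_sum]
    refine Finset.sum_congr rfl fun k _ => ?_
    rw [smul_mul_assoc, mul_smul_comm, hEz k t ht]
  -- `G` is the part of the product of the two u-independent L-operators that commutes with `z`, and
  -- hence with R.
  obtain ⟨G, hG⟩ : ∃ G, G = ϵ • (X₀ * X₁ * (D₀ * D₁)) + (1 / 2 : ℂ) • Y - (ϵ / 2) • (Y' * z) -
      (1 / 2 : ℂ) • (h * Y) + (1 / 4 : ℂ) • (h * h) := ⟨_, rfl⟩
  have hzG : z * G = G * z := by
    rw [hG]
    simp only [mul_add, add_mul, mul_sub, sub_mul, mul_smul_comm, smul_mul_assoc]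
    rw [← mul_assoc z (X₀ * X₁), hXX, mul_assoc _ z, hDD, hzY, ← mul_assoc z Y', hzY',
      ← mul_assoc z h Y, ← mul_assoc z h h, hz, mul_assoc h z Y, mul_assoc h z h, hzY, hz]
    simp only [mul_assoc]
  have hAA : (X₀ * D₀ - (1 / 2 : ℂ) • h) * (X₁ * D₁ - (1 / 2 : ℂ) • h) =
      G + (1 / 2 : ℂ) • b + (ϵ / 2) • (d * z) := by
    have h1 : X₀ * D₀ * (X₁ * D₁) = ϵ • (X₀ * X₁ * (D₀ * D₁)) + X₀ * D₀ - ϵ • (X₀ * D₁ * z) := by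
      rw [mul_assoc, ← mul_assoc D₀, hDX, add_mul, mul_add, hD₁, mul_sub]
      simp only [mul_smul_comm, smul_mul_assoc, mul_assoc]
      module
    rw [hG, hY, hY', hb, hd]
    simp only [mul_add, add_mul, mul_sub, sub_mul, mul_smul_comm, smul_mul_assoc]
    rw [h1, ← hh]
    linear_combination (norm := module) (0 : ℂ) • h1
  have hfin : R * ((u + v) • 1 + X₀ * D₀ - (1 / 2 : ℂ) • h) *
        (v • 1 + X₁ * D₁ - (1 / 2 : ℂ) • h) -
      (v • 1 + X₀ * D₀ - (1 / 2 : ℂ) • h) * ((u + v) • 1 + X₁ * D₁ - (1 / 2 : ℂ) • h) * R =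
      (1 / 2 : ℂ) • ((-u) • (R * b + b * R) + (R * b - b * R) + ϵ • ((R * d - d * R) * z)) := by
    obtain ⟨A₀, hA₀⟩ : ∃ A₀, A₀ = X₀ * D₀ - (1 / 2 : ℂ) • h := ⟨_, rfl⟩
    obtain ⟨A₁, hA₁⟩ : ∃ A₁, A₁ = X₁ * D₁ - (1 / 2 : ℂ) • h := ⟨_, rfl⟩
    have e₀ : A₀ = (1 / 2 : ℂ) • (Y + b - h) := by rw [hA₀, hY, hb]; module
    have e₁ : A₁ = (1 / 2 : ℂ) • (Y - b - h) := by rw [hA₁, hY, hb]; module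
    have hRd : d * z * R = d * R * z := by rw [mul_assoc, ← hRz z rfl, mul_assoc]
    rw [← hA₀, ← hA₁] at hAA
    rw [add_sub_assoc, add_sub_assoc, add_sub_assoc, add_sub_assoc, ← hA₀, ← hA₁]
    have h1 : R * ((u + v) • 1 + A₀) * (v • 1 + A₁) - (v • 1 + A₀) * ((u + v) • 1 + A₁) * R =
        u • (R * A₁ - A₀ * R) + v • (R * (A₀ + A₁) - (A₀ + A₁) * R) +
          (R * (A₀ * A₁) - A₀ * A₁ * R) := by
      simp only [mul_add, add_mul, mul_smul_comm, smul_mul_assoc, mul_one, one_mul, mul_assoc]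
      module
    rw [h1, hAA, e₀, e₁]
    simp only [mul_add, add_mul, mul_sub, sub_mul, mul_smul_comm, smul_mul_assoc, hRd,
      hRz Y hzY, hRz h hz, hRz G hzG, ← mul_assoc]
    module
  obtain ⟨s, hs⟩ := IsAlgClosed.exists_eq_mul_self ϵ
  have hs0 : s ≠ 0 := by rintro rfl; rw [hs] at hϵ; simp at hϵ
  have hsϵ : s⁻¹ * s⁻¹ = ϵ := by
    rw [← mul_inv, ← hs]; exact inv_eq_of_mul_eq_one_left hϵ
  -- The difference over `s` and `-s` recovers `b` and `d` from the eigenvectors. The terms `[E k,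
  -- b] z` and `[E k, d]` cancel, and `s⁻² = ϵ` supplies the coefficient of `[E k, d] z`.
  have hsum : (1 / 2 : ℂ) • ((-u) • (R * b + b * R) + (R * b - b * R) +
        ϵ • ((R * d - d * R) * z)) =
      (s⁻¹ / 4) • (∑ k ∈ Finset.range (K + 2), c k •
        ((-u) • (E k * (d + s • b) + (d + s • b) * E k) +
          (E k * (d + s • b) - (d + s • b) * E k) * (s⁻¹ • z + 1)) -
        ∑ k ∈ Finset.range (K + 2), c k •
        ((-u) • (E k * (d + (-s) • b) + (d + (-s) • b) * E k) +
          (E k * (d + (-s) • b) - (d + (-s) • b) * E k) * ((-s)⁻¹ • z + 1))) := by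
    rw [← Finset.sum_sub_distrib, hR]
    simp only [Finset.sum_mul, Finset.mul_sum, Finset.smul_sum, ← Finset.sum_add_distrib,
      ← Finset.sum_sub_distrib]
    refine Finset.sum_congr rfl fun k _ => ?_
    have hs1 : s⁻¹ * s = 1 := inv_mul_cancel₀ hs0
    rw [inv_neg]
    simp only [mul_add, add_mul, sub_mul, mul_smul_comm, smul_mul_assoc, mul_one]
    match_scalars
    · linear_combination (-(1 - u) * c k / 2) * hs1
    · linear_combination ((1 + u) * c k / 2) * hs1
    · linear_combination (-c k / 2) * hsϵ
    · linear_combination (c k / 2) * hsϵ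
    all_goals ring
  rw [hfin, hsum]
  exact N.smul_mem _ (N.sub_mem (hmem s hs.symm) (hmem (-s) (by rw [neg_mul_neg, hs])))

end Core

namespace SuperMetric

variable {ι : Type*} [Fintype ι] [DecidableEq ι] (S : SuperMetric ι)

/-! ### The L-operators in terms of index-free generators -/

theorem z_mul_osc_zero (c : ι) : S.z * S.osc (0, c) =
    S.eps • S.osc (1, c) - S.eps • (S.osc (0, c) * S.z) := by
  have h : S.osc (0, c) * S.z = (-S.eps) • (S.z * S.osc (0, c)) + S.osc (1, c) :=
    S.mul_pair_zero fun v' => S.osc_mul (0, c) v'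
  have h1 := S.eps_mul_self
  rw [h]
  linear_combination (norm := module) (-h1) • (S.z * S.osc (0, c))

theorem z_mul_osc_one (c : ι) : S.z * S.osc (1, c) =
    S.osc (0, c) - S.eps • (S.osc (1, c) * S.z) := by
  have h : S.osc (1, c) * S.z = (-S.eps) • (S.z * S.osc (1, c)) + S.eps • S.osc (0, c) :=
    S.mul_pair_one fun v' => S.osc_mul (1, c) v'
  have h1 := S.eps_mul_self
  rw [h]
  linear_combination (norm := module) (-h1) • (S.z * S.osc (1, c)) + h1 • S.osc (0, c)

theorem z_mul_hgen (y : ι ⊕ ι) : S.z * S.hgen y = S.hgen y * S.z := by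
  simp only [z, pair, Finset.sum_mul, Finset.mul_sum]
  refine Finset.sum_congr rfl fun a _ => Finset.sum_congr rfl fun b _ => ?_
  by_cases hg : S.g a b = 0
  · simp [hg]
  · rw [smul_mul_assoc, mul_smul_comm, mul_assoc, osc_mul_hgen, mul_smul_comm, ← mul_assoc,
      osc_mul_hgen, smul_mul_assoc, S.deg_eq_of_g hg, smul_smul, smul_smul, mul_assoc (S.g a b),
      sgn_mul_self, mul_one, mul_assoc]

/-- The variable `x_a` in the graded tensor product. -/
def tx (a : ι) : S.Tensor := S.hgen (Sum.inl a)

/-- The derivative `∂_a` in the graded tensor product. -/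
def td (a : ι) : S.Tensor := S.hgen (Sum.inr a)

theorem inHeis_x (a : ι) : S.inHeis (S.x a) = S.tx a := rfl

theorem inHeis_d (a : ι) : S.inHeis (S.d a) = S.td a := rfl

theorem x_mul_x (a b : ι) : S.x a * S.x b = S.exch a b • (S.x b * S.x a) := by
  have h := RingQuot.mkAlgHom_rel ℂ (HeisRel.xx (S := S) a b)
  rw [map_smul, map_mul, map_mul] at h
  exact h

theorem d_mul_d (a b : ι) : S.d a * S.d b = S.exch a b • (S.d b * S.d a) := by
  have h := RingQuot.mkAlgHom_rel ℂ (HeisRel.dd (S := S) a b)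
  rw [map_smul, map_mul, map_mul] at h
  exact h

theorem d_mul_x (a b : ι) : S.d a * S.x b = S.g a b • 1 + S.exch a b • (S.x b * S.d a) := by
  have h := RingQuot.mkAlgHom_rel ℂ (HeisRel.dx (S := S) a b)
  rw [map_sub, map_smul, map_mul, map_mul, AlgHom.commutes, sub_eq_iff_eq_add,
    Algebra.algebraMap_eq_smul_one] at h
  exact h

theorem tx_mul_tx (a b : ι) : S.tx a * S.tx b = S.exch a b • (S.tx b * S.tx a) := by
  rw [← inHeis_x, ← inHeis_x, ← map_mul, x_mul_x, map_smul, map_mul]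

theorem td_mul_td (a b : ι) : S.td a * S.td b = S.exch a b • (S.td b * S.td a) := by
  rw [← inHeis_d, ← inHeis_d, ← map_mul, d_mul_d, map_smul, map_mul]

theorem td_mul_tx (a b : ι) : S.td a * S.tx b = S.g a b • 1 + S.exch a b • (S.tx b * S.td a) := by
  rw [← inHeis_d, ← inHeis_x, ← map_mul, d_mul_x, map_add, map_smul, map_smul, map_mul, map_one]

theorem osc_mul_tx (j : Fin 2) (a b : ι) : S.osc (j, a) * S.tx b =
    sgn (S.deg a * S.deg b) • (S.tx b * S.osc (j, a)) := S.osc_mul_hgen (j, a) (Sum.inl b)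

theorem osc_mul_td (j : Fin 2) (a b : ι) : S.osc (j, a) * S.td b =
    sgn (S.deg a * S.deg b) • (S.td b * S.osc (j, a)) := S.osc_mul_hgen (j, a) (Sum.inr b)

theorem tx_mul_osc (j : Fin 2) (a b : ι) : S.tx a * S.osc (j, b) =
    sgn (S.deg a * S.deg b) • (S.osc (j, b) * S.tx a) := by
  rw [mul_comm (S.deg a)]; exact S.hgen_mul_osc (j, b) (Sum.inl a)

theorem td_mul_osc (j : Fin 2) (a b : ι) : S.td a * S.osc (j, b) =
    sgn (S.deg a * S.deg b) • (S.osc (j, b) * S.td a) := by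
  rw [mul_comm (S.deg a)]; exact S.hgen_mul_osc (j, b) (Sum.inr a)

/-- The element `x_a c_j^a`. -/
def X (j : Fin 2) : S.Tensor := ∑ a, S.tx a * S.osc (j, a)

/-- The element `c_j^a ∂_a`. -/
def D (j : Fin 2) : S.Tensor := ∑ a, S.osc (j, a) * S.td a

/-- The Euler operator `ε^{ab} x_a ∂_b`. -/
def euler : S.Tensor := ∑ a, ∑ b, S.g⁻¹ a b • (S.tx a * S.td b)

/-! ### Relations among `z`, `X_j`, `D_j` and the Euler operator -/

theorem z_mul_X_zero : S.z * S.X 0 = S.eps • S.X 1 - S.eps • (S.X 0 * S.z) := by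
  simp only [X, Finset.mul_sum, Finset.sum_mul, Finset.smul_sum]
  rw [← Finset.sum_sub_distrib]
  refine Finset.sum_congr rfl fun a _ => ?_
  rw [← mul_assoc, tx, z_mul_hgen, mul_assoc, z_mul_osc_zero, mul_sub, mul_smul_comm,
    mul_smul_comm, mul_assoc]

theorem z_mul_X_one : S.z * S.X 1 = S.X 0 - S.eps • (S.X 1 * S.z) := by
  simp only [X, Finset.mul_sum, Finset.sum_mul, Finset.smul_sum]
  rw [← Finset.sum_sub_distrib]
  refine Finset.sum_congr rfl fun a _ => ?_
  rw [← mul_assoc, tx, z_mul_hgen, mul_assoc, z_mul_osc_one, mul_sub, mul_smul_comm, mul_assoc]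

theorem z_mul_D_zero : S.z * S.D 0 = S.eps • S.D 1 - S.eps • (S.D 0 * S.z) := by
  simp only [D, Finset.mul_sum, Finset.sum_mul, Finset.smul_sum]
  rw [← Finset.sum_sub_distrib]
  refine Finset.sum_congr rfl fun a _ => ?_
  rw [← mul_assoc, z_mul_osc_zero, sub_mul, smul_mul_assoc, smul_mul_assoc, mul_assoc, mul_assoc,
    td, z_mul_hgen]

theorem z_mul_D_one : S.z * S.D 1 = S.D 0 - S.eps • (S.D 1 * S.z) := by
  simp only [D, Finset.mul_sum, Finset.sum_mul, Finset.smul_sum]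
  rw [← Finset.sum_sub_distrib]
  refine Finset.sum_congr rfl fun a _ => ?_
  rw [← mul_assoc, z_mul_osc_one, sub_mul, smul_mul_assoc, mul_assoc, mul_assoc, td, z_mul_hgen]

theorem z_mul_euler : S.z * S.euler = S.euler * S.z := by
  simp only [euler, Finset.mul_sum, Finset.sum_mul]
  refine Finset.sum_congr rfl fun a _ => Finset.sum_congr rfl fun b _ => ?_
  rw [mul_smul_comm, smul_mul_assoc, ← mul_assoc, tx, td, z_mul_hgen, mul_assoc, z_mul_hgen,
    mul_assoc]

/-- Adding the double sum to its relabelled copy replaces `c^a c^b` by the defining relation of the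
oscillators. Only the contraction survives, and it does not remember the copy `j`. -/
theorem two_smul_X_mul_X (j : Fin 2) : (2 : ℂ) • (S.X j * S.X j) =
    ∑ a, ∑ b, (sgn (S.deg a * S.deg b) * S.g⁻¹ a b) • (S.tx a * S.tx b) := by
  have h1 : S.X j * S.X j = ∑ a, ∑ b, sgn (S.deg a * S.deg b) •
      (S.tx a * S.tx b * (S.osc (j, a) * S.osc (j, b))) := by
    simp only [X, Finset.mul_sum, Finset.sum_mul]
    rw [Finset.sum_comm]
    refine Finset.sum_congr rfl fun a _ => Finset.sum_congr rfl fun b _ => ?_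
    rw [mul_assoc, ← mul_assoc (S.osc _), osc_mul_tx, smul_mul_assoc, mul_smul_comm]
    simp only [mul_assoc]
  have h2 : S.X j * S.X j = ∑ a, ∑ b, sgn (S.deg a * S.deg b) •
      (S.tx b * S.tx a * (S.osc (j, b) * S.osc (j, a))) := by
    rw [h1, Finset.sum_comm]
    refine Finset.sum_congr rfl fun a _ => Finset.sum_congr rfl fun b _ => ?_
    rw [mul_comm (S.deg a)]
  rw [two_smul]
  conv_lhs => enter [1]; rw [h1]
  conv_lhs => enter [2]; rw [h2]
  rw [← Finset.sum_add_distrib]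
  refine Finset.sum_congr rfl fun a _ => ?_
  rw [← Finset.sum_add_distrib]
  refine Finset.sum_congr rfl fun b _ => ?_
  rw [S.tx_mul_tx b a, S.osc_mul (j, a) (j, b), S.exch_comm b a]
  simp only [con, fac, if_true, mul_add, mul_smul_comm, smul_mul_assoc, mul_one]
  module

theorem two_smul_D_mul_D (j : Fin 2) : (2 : ℂ) • (S.D j * S.D j) =
    ∑ a, ∑ b, (sgn (S.deg a * S.deg b) * S.g⁻¹ a b) • (S.td a * S.td b) := by
  have h1 : S.D j * S.D j = ∑ a, ∑ b, sgn (S.deg a * S.deg b) •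
      (S.osc (j, a) * S.osc (j, b) * (S.td a * S.td b)) := by
    simp only [D, Finset.mul_sum, Finset.sum_mul]
    rw [Finset.sum_comm]
    refine Finset.sum_congr rfl fun a _ => Finset.sum_congr rfl fun b _ => ?_
    rw [mul_assoc, ← mul_assoc (S.td _), td_mul_osc, smul_mul_assoc, mul_smul_comm]
    simp only [mul_assoc]
  have h2 : S.D j * S.D j = ∑ a, ∑ b, sgn (S.deg a * S.deg b) •
      (S.osc (j, b) * S.osc (j, a) * (S.td b * S.td a)) := by
    rw [h1, Finset.sum_comm]
    refine Finset.sum_congr rfl fun a _ => Finset.sum_congr rfl fun b _ => ?_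
    rw [mul_comm (S.deg a)]
  rw [two_smul]
  conv_lhs => enter [1]; rw [h1]
  conv_lhs => enter [2]; rw [h2]
  rw [← Finset.sum_add_distrib]
  refine Finset.sum_congr rfl fun a _ => ?_
  rw [← Finset.sum_add_distrib]
  refine Finset.sum_congr rfl fun b _ => ?_
  rw [S.td_mul_td b a, S.osc_mul (j, a) (j, b), S.exch_comm b a]
  simp only [con, fac, if_true, add_mul, mul_smul_comm, smul_mul_assoc, one_mul]
  module

theorem X_mul_X : S.X 0 * S.X 0 = S.X 1 * S.X 1 :=
  smul_right_injective _ (two_ne_zero (α := ℂ))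
    ((S.two_smul_X_mul_X 0).trans (S.two_smul_X_mul_X 1).symm)

theorem D_mul_D : S.D 0 * S.D 0 = S.D 1 * S.D 1 :=
  smul_right_injective _ (two_ne_zero (α := ℂ))
    ((S.two_smul_D_mul_D 0).trans (S.two_smul_D_mul_D 1).symm)

/-- Contracting `∂` with `x` glues oscillators from different copies into `z`; this is how `z`
appears in the product of two L-operators. -/
theorem D_mul_X : S.D 0 * S.X 1 = S.eps • (S.X 1 * S.D 0) + S.z := by
  simp only [D, X, z, pair, Finset.mul_sum, Finset.sum_mul, Finset.smul_sum]
  rw [Finset.sum_comm]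
  rw [← Finset.sum_add_distrib]
  refine Finset.sum_congr rfl fun b _ => ?_
  rw [← Finset.sum_add_distrib]
  refine Finset.sum_congr rfl fun a _ => ?_
  have h1 : S.osc (0, b) * S.td b * (S.tx a * S.osc (1, a)) =
      S.osc (0, b) * (S.td b * S.tx a) * S.osc (1, a) := by simp only [mul_assoc]
  have h2 : S.osc (0, b) * (S.tx a * S.td b) * S.osc (1, a) =
      sgn (S.deg b * S.deg a) • (S.tx a * S.osc (1, a) * (S.osc (0, b) * S.td b)) := by
    rw [← mul_assoc, osc_mul_tx, smul_mul_assoc, smul_mul_assoc, mul_assoc, td_mul_osc,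
      mul_smul_comm, smul_smul, sgn_mul_self, one_smul, mul_assoc, ← mul_assoc (S.osc _),
      S.osc_mul (0, b) (1, a)]
    simp [con, fac, mul_assoc]
  rw [h1, td_mul_tx, mul_add, add_mul, mul_smul_comm, mul_smul_comm, smul_mul_assoc,
    smul_mul_assoc, h2, mul_one, smul_smul, exch, mul_assoc, sgn_mul_self, mul_one, add_comm]

theorem euler_mul_tx (c : ι) : S.euler * S.tx c = S.tx c * S.euler + S.tx c := by
  have h : S.tx c = ∑ a, ∑ b, (S.g⁻¹ a b * S.g b c) • S.tx a := by
    simp_rw [← Finset.sum_smul, sum_ginv_g]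
    simp
  conv_rhs => enter [2]; rw [h]
  simp only [euler, Finset.mul_sum, Finset.sum_mul]
  rw [← Finset.sum_add_distrib]
  refine Finset.sum_congr rfl fun a _ => ?_
  rw [← Finset.sum_add_distrib]
  refine Finset.sum_congr rfl fun b _ => ?_
  by_cases hg : S.g⁻¹ a b = 0
  · simp [hg]
  · have h2 : S.exch b c * S.exch a c = 1 := by
      rw [exch, exch, ← S.deg_eq_of_ginv hg, ← exch, exch_mul_self]
    rw [smul_mul_assoc, mul_assoc, td_mul_tx, mul_add, mul_smul_comm, mul_smul_comm, ← mul_assoc,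
      tx_mul_tx, smul_mul_assoc, smul_smul, h2, one_smul, mul_one, mul_smul_comm, mul_assoc]
    module

theorem td_mul_euler (c : ι) : S.td c * S.euler = S.euler * S.td c + S.td c := by
  have h : S.td c = ∑ b, ∑ a, (S.g c a * S.g⁻¹ a b) • S.td b := by
    simp_rw [← Finset.sum_smul, sum_g_ginv]
    simp
  conv_rhs => enter [2]; rw [h, Finset.sum_comm]
  simp only [euler, Finset.mul_sum, Finset.sum_mul]
  rw [← Finset.sum_add_distrib]
  refine Finset.sum_congr rfl fun a _ => ?_
  rw [← Finset.sum_add_distrib]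
  refine Finset.sum_congr rfl fun b _ => ?_
  by_cases hg : S.g⁻¹ a b = 0
  · simp [hg]
  · have h2 : S.exch c a * S.exch c b = 1 := by
      rw [exch, exch, ← S.deg_eq_of_ginv hg, ← exch, exch_mul_self]
    rw [mul_smul_comm, ← mul_assoc, td_mul_tx, add_mul, smul_mul_assoc, smul_mul_assoc, mul_assoc,
      td_mul_td, mul_smul_comm, smul_smul, h2, one_smul, one_mul, smul_mul_assoc, mul_assoc]
    module

theorem osc_mul_euler (j : Fin 2) (c : ι) : S.osc (j, c) * S.euler = S.euler * S.osc (j, c) := by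
  simp only [euler, Finset.mul_sum, Finset.sum_mul]
  refine Finset.sum_congr rfl fun a _ => Finset.sum_congr rfl fun b _ => ?_
  by_cases hg : S.g⁻¹ a b = 0
  · simp [hg]
  · rw [mul_smul_comm, smul_mul_assoc, ← mul_assoc, osc_mul_tx, smul_mul_assoc, mul_assoc,
      osc_mul_td, mul_smul_comm, S.deg_eq_of_ginv hg, smul_smul, smul_smul, mul_assoc (S.g⁻¹ a b),
      sgn_mul_self, mul_one, mul_assoc]

theorem euler_mul_X (j : Fin 2) : S.euler * S.X j = S.X j * S.euler + S.X j := by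
  simp only [X, Finset.mul_sum, Finset.sum_mul]
  rw [← Finset.sum_add_distrib]
  refine Finset.sum_congr rfl fun a _ => ?_
  rw [← mul_assoc, euler_mul_tx, add_mul, mul_assoc, mul_assoc, osc_mul_euler]

theorem D_mul_euler (j : Fin 2) : S.D j * S.euler = S.euler * S.D j + S.D j := by
  simp only [D, Finset.mul_sum, Finset.sum_mul]
  rw [← Finset.sum_add_distrib]
  refine Finset.sum_congr rfl fun a _ => ?_
  rw [mul_assoc, td_mul_euler, mul_add, ← mul_assoc, osc_mul_euler, mul_assoc]

theorem euler_mul_X_mul_D (j : Fin 2) :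
    S.euler * (S.X j * S.D j) = S.X j * S.D j * S.euler := by
  rw [← mul_assoc, euler_mul_X, mul_assoc, D_mul_euler, add_mul, mul_add, mul_assoc]

theorem inOsc_symProd_two (j : Fin 2) (a b : ι) : S.inOsc j (S.symProd ![a, b]) =
    S.osc (j, a) * S.osc (j, b) + (-1 / 2 * S.g⁻¹ a b) • 1 := by
  have h1 : ∀ v, S.cre v 1 = S.osc v := by
    intro v
    rw [cre, LinearMap.smul_apply, LinearMap.add_apply, lop_apply, rop_apply, map_one, mul_one,
      one_mul]
    module
  rw [inOsc_symProd, creWord_succ, creWord_succ, creWord_zero, h1]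
  have h2 := LinearMap.congr_fun (S.lop_eq (j, a)) (S.osc (j, b))
  have h3 : S.ann (j, a) (S.osc (j, b)) = S.g⁻¹ a b • 1 := by
    rw [ann_apply, twist_osc, osc_mul, smul_mul_assoc, add_sub_cancel_right]
    simp [con]
  rw [LinearMap.add_apply, LinearMap.smul_apply, h3, lop_apply] at h2
  simp only [Matrix.cons_val_zero, Fin.succ_zero_eq_one, Matrix.cons_val_one]
  rw [h2]
  module

theorem symProd_two_swap (j : Fin 2) (a b : ι) : S.inOsc j (S.symProd ![b, a]) =
    (-S.exch a b) • S.inOsc j (S.symProd ![a, b]) := by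
  rw [inOsc_symProd_two, inOsc_symProd_two, osc_mul]
  have h := S.ginv_symm b a
  have h2 := S.exch_mul_self a b
  rw [S.exch_comm b a] at h
  simp only [con, fac, if_true, S.exch_comm b a]
  rw [h]
  module

/-- The graded antisymmetry of `F` makes both terms of M contribute equally. Replacing the
symmetrized product by `c^a c^b` minus half its contraction then leaves the Euler operator. -/
theorem L_eq (j : Fin 2) (u : ℂ) :
    S.L j u = u • 1 + S.X j * S.D j - (1 / 2 : ℂ) • S.euler := by
  have hsum : ∑ a, ∑ b, S.inOsc j (S.F a b) * S.inHeis (S.M b a) =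
      ∑ a, ∑ b, (-2 * sgn (S.deg a) * sgn (S.deg a * S.deg b)) •
        (S.inOsc j (S.symProd ![a, b]) * (S.tx a * S.td b)) := by
    have h1 : ∀ a b, S.inOsc j (S.F a b) * S.inHeis (S.M b a) =
        (S.eps * sgn (S.deg b)) • (S.inOsc j (S.symProd ![a, b]) * (S.tx b * S.td a)) +
        (-(sgn (S.deg a) * sgn (S.deg a * S.deg b))) •
          (S.inOsc j (S.symProd ![a, b]) * (S.tx a * S.td b)) := by
      intro a b
      have h2 := S.eps_mul_self
      have h3 := sgn_mul_self (S.deg b)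
      rw [F, M, map_smul, map_sub, map_smul, map_mul, map_mul, inHeis_x, inHeis_x, inHeis_d,
        inHeis_d, smul_mul_assoc, mul_sub, mul_smul_comm, exchM, sgn_add, sgn_add,
        mul_comm (S.deg b)]
      match_scalars
      · ring
      · linear_combination (-sgn (S.deg a) * sgn (S.deg a * S.deg b)) *
          (sgn (S.deg b) ^ 2 * h2 + h3)
    simp_rw [h1, Finset.sum_add_distrib]
    rw [Finset.sum_comm, ← Finset.sum_add_distrib]
    refine Finset.sum_congr rfl fun a _ => ?_
    rw [← Finset.sum_add_distrib]
    refine Finset.sum_congr rfl fun b _ => ?_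
    have h2 := S.eps_mul_self
    rw [S.symProd_two_swap j a b, exch, smul_mul_assoc]
    match_scalars
    linear_combination (-sgn (S.deg a) * sgn (S.deg a * S.deg b)) * h2
  rw [L, hsum, X, D, euler]
  simp only [Finset.mul_sum, Finset.sum_mul, Finset.smul_sum]
  rw [add_sub_assoc, sub_eq_add_neg]
  congr 1
  rw [Finset.sum_comm (f := fun i j_1 => S.tx j_1 * S.osc (j, j_1) * _), ← Finset.sum_neg_distrib,
    ← Finset.sum_sub_distrib]
  refine Finset.sum_congr rfl fun a _ => ?_
  rw [← Finset.sum_neg_distrib, ← Finset.sum_sub_distrib]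
  refine Finset.sum_congr rfl fun b _ => ?_
  have h4 : S.tx a * S.osc (j, a) * (S.osc (j, b) * S.td b) =
      (sgn (S.deg a * S.deg a) * sgn (S.deg a * S.deg b)) •
        (S.osc (j, a) * S.osc (j, b) * (S.tx a * S.td b)) := by
    rw [tx_mul_osc, smul_mul_assoc, mul_assoc, ← mul_assoc (S.tx a), tx_mul_osc, smul_mul_assoc,
      mul_smul_comm, smul_smul]
    simp only [mul_assoc]
  have h5 : ∀ x : ZMod 2, x * x = x := by decide
  rw [h4, h5, inOsc_symProd_two, add_mul, smul_mul_assoc, one_mul]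
  by_cases hg : S.g⁻¹ a b = 0
  · simp only [hg]; module
  · have h6 : sgn (S.deg a) * sgn (S.deg a * S.deg b) = 1 := by
      rw [S.deg_eq_of_ginv hg, h5, sgn_mul_self]
    match_scalars
    · ring
    · linear_combination (-1 / 2 * S.g⁻¹ a b) * h6

/-! ### The filtration by degree -/

theorem highDegree_antitone {n m : ℕ} (h : n ≤ m) : S.highDegree m ≤ S.highDegree n := by
  apply Submodule.span_mono
  rintro t ⟨k, l, a, b, y, hkl, rfl⟩
  exact ⟨k, l, a, b, y, h.trans hkl, rfl⟩

/-- A normal ordered word of creation operators, applied to an element of `ℋ`. -/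
def normalWord {k l : ℕ} (a : Fin k → ι) (b : Fin l → ι) (h : S.Heis) : S.Tensor :=
  S.creOp 0 a (S.creOp 1 b (S.inHeis h))

theorem normalWord_eq {k l : ℕ} (a : Fin k → ι) (b : Fin l → ι) (h : S.Heis) :
    S.inOsc 0 (S.symProd a) * S.inOsc 1 (S.symProd b) * S.inHeis h = S.normalWord a b h := by
  rw [inOsc_symProd, inOsc_symProd, mul_assoc, creWord_mul, creWord_mul, normalWord]
  · exact fun _ => S.ann_inHeis _ _
  · exact fun _ => S.ann_mul_eq_zero (S.ann_creWord (by simp) _) (S.ann_inHeis _ _)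

theorem normalWord_mem {k l : ℕ} (a : Fin k → ι) (b : Fin l → ι) (h : S.Heis) {n : ℕ}
    (hn : n ≤ k + l) : S.normalWord a b h ∈ S.highDegree n :=
  Submodule.subset_span ⟨k, l, a, b, h, hn, (S.normalWord_eq a b h).symm⟩

theorem map_highDegree {φ : Module.End ℂ S.Tensor} {n m : ℕ}
    (hφ : ∀ (k l : ℕ) (a : Fin k → ι) (b : Fin l → ι) (h : S.Heis), n ≤ k + l →
      φ (S.normalWord a b h) ∈ S.highDegree m) {t : S.Tensor} (ht : t ∈ S.highDegree n) :
    φ t ∈ S.highDegree m := by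
  have : S.highDegree n ≤ (S.highDegree m).comap φ := by
    apply Submodule.span_le.mpr
    rintro t ⟨k, l, a, b, h, hkl, rfl⟩
    rw [normalWord_eq]
    exact hφ k l a b h hkl
  exact this ht

/-! ### Effect of creation and annihilation operators on the degree -/

theorem cre_creOp (v : Fin 2 × ι) (j : Fin 2) {k : ℕ} (a : Fin k → ι) :
    S.cre v * S.creOp j a = (∏ i, S.fac v (j, a i)) • (S.creOp j a * S.cre v) := by
  induction k with
  | zero => simp [creOp]
  | succ k ih =>
    rw [creOp_succ, ← mul_assoc, cre_cre, smul_mul_assoc, mul_assoc, ih, mul_smul_comm, smul_smul,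
      Fin.prod_univ_succ, mul_assoc]

theorem creOp_cons (j : Fin 2) {k : ℕ} (c : ι) (a : Fin k → ι) :
    S.creOp j (Fin.cons c a) = S.cre (j, c) * S.creOp j a := by
  rw [creOp_succ]; simp

theorem cre_highDegree (v : Fin 2 × ι) {n : ℕ} {t : S.Tensor} (ht : t ∈ S.highDegree n) :
    S.cre v t ∈ S.highDegree (n + 1) := by
  refine S.map_highDegree (fun k l a b h hkl => ?_) ht
  obtain ⟨j, c⟩ := v
  match j with
  | 0 =>
    have h1 : S.cre (0, c) (S.normalWord a b h) = S.normalWord (Fin.cons c a) b h := by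
      rw [normalWord, normalWord, creOp_cons]; rfl
    rw [h1]
    exact S.normalWord_mem _ _ _ (by omega)
  | 1 =>
    have h1 := LinearMap.congr_fun (S.cre_creOp (1, c) 0 a) (S.creOp 1 b (S.inHeis h))
    have h2 : S.cre (1, c) (S.normalWord a b h) =
        (∏ i, S.fac (1, c) (0, a i)) • S.normalWord a (Fin.cons c b) h := by
      rw [normalWord, normalWord, creOp_cons]; exact h1
    rw [h2]
    exact Submodule.smul_mem _ _ (S.normalWord_mem _ _ _ (by omega))

/-- An annihilation operator removes one letter by contraction or moves on to the next. The
truncated subtraction is harmless at the empty word, where `ann` kills the element of `ℋ`. -/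
theorem ann_normalWord (v : Fin 2 × ι) {k l : ℕ} (a : Fin k → ι) (b : Fin l → ι) (h : S.Heis) :
    S.ann v (S.normalWord a b h) ∈ S.highDegree (k + l - 1) := by
  have step : ∀ (v' : Fin 2 × ι) (t : S.Tensor) (n : ℕ), t ∈ S.highDegree n →
      S.ann v t ∈ S.highDegree (n - 1) → S.ann v (S.cre v' t) ∈ S.highDegree n := by
    intro v' t n ht ha
    have h1 := LinearMap.congr_fun (S.ann_cre v v') t
    simp only [Module.End.mul_apply, LinearMap.add_apply, LinearMap.smul_apply,
      Module.End.one_apply] at h1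
    rw [h1]
    exact Submodule.add_mem _ (Submodule.smul_mem _ _ ht) (Submodule.smul_mem _ _
      (S.highDegree_antitone (by omega) (S.cre_highDegree v' ha)))
  induction k with
  | zero =>
    have h0 : ∀ (l : ℕ) (b : Fin l → ι), S.normalWord a b h = S.creOp 1 b (S.inHeis h) := by
      intro l b; simp [normalWord, creOp]
    induction l with
    | zero =>
      rw [h0]
      simp [creOp, ann_inHeis]
    | succ l ih =>
      have h1 := step (1, b 0) _ (0 + l) (S.normalWord_mem a (fun i => b i.succ) h le_rfl) (ih _)
      rw [h0, creOp_succ]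
      rw [h0] at h1
      exact h1
  | succ k ih =>
    have h1 := step (0, a 0) _ (k + l) (S.normalWord_mem (fun i => a i.succ) b h le_rfl) (ih _)
    rw [normalWord, creOp_succ]
    exact S.highDegree_antitone (by omega) h1

theorem ann_highDegree (v : Fin 2 × ι) {n : ℕ} {t : S.Tensor} (ht : t ∈ S.highDegree (n + 1)) :
    S.ann v t ∈ S.highDegree n :=
  S.map_highDegree (fun _ _ a b h hkl =>
    S.highDegree_antitone (by omega) (S.ann_normalWord v a b h)) ht

theorem twist_inHeis (v : Fin 2 × ι) (h : S.Heis) : ∃ h', S.twist v (S.inHeis h) = S.inHeis h' := by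
  induction h using S.heis_induction with
  | hs r => exact ⟨algebraMap ℂ _ r, by rw [AlgHom.commutes, AlgHom.commutes]⟩
  | hg y => exact ⟨_, (S.twist_hgen v y).trans (map_smul S.inHeis _ _).symm⟩
  | hm a b ha hb =>
    obtain ⟨a', ha⟩ := ha
    obtain ⟨b', hb⟩ := hb
    exact ⟨a' * b', by rw [map_mul, map_mul, ha, hb, map_mul]⟩
  | ha a b ha hb =>
    obtain ⟨a', ha⟩ := ha
    obtain ⟨b', hb⟩ := hb
    exact ⟨a' + b', by rw [map_add, map_add, ha, hb, map_add]⟩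

theorem twist_highDegree (v : Fin 2 × ι) {n : ℕ} {t : S.Tensor} (ht : t ∈ S.highDegree n) :
    S.twist v t ∈ S.highDegree n := by
  refine S.map_highDegree (φ := (S.twist v).toLinearMap) (fun k l a b h hkl => ?_) ht
  obtain ⟨h', hh⟩ := S.twist_inHeis v h
  rw [AlgHom.toLinearMap_apply, ← normalWord_eq, map_mul, map_mul, hh, inOsc_symProd,
    inOsc_symProd, twist_creWord, twist_creWord, smul_mul_smul_comm, smul_mul_assoc,
    ← inOsc_symProd, ← inOsc_symProd, normalWord_eq]
  exact Submodule.smul_mem _ _ (S.normalWord_mem _ _ _ hkl)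

theorem hgen_mul_cre (y : ι ⊕ ι) (v : Fin 2 × ι) (t : S.Tensor) :
    S.hgen y * S.cre v t = sgn (S.deg v.2 * S.degH y) • S.cre v (S.hgen y * t) := by
  have h := sgn_mul_self (S.deg v.2 * S.degH y)
  have h2 : S.hgen y * (S.osc v * t) =
      sgn (S.deg v.2 * S.degH y) • (S.osc v * (S.hgen y * t)) := by
    rw [← mul_assoc, hgen_mul_osc, smul_mul_assoc, mul_assoc]
  simp only [cre, LinearMap.smul_apply, LinearMap.add_apply, lop_apply, rop_apply, map_mul,
    twist_hgen, mul_smul_comm, smul_mul_assoc, mul_add, h2, smul_add, mul_assoc]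
  match_scalars
  · ring
  · linear_combination (-1 / 2) * h

theorem hgen_mul_creOp (y : ι ⊕ ι) (j : Fin 2) {k : ℕ} (a : Fin k → ι) (t : S.Tensor) :
    S.hgen y * S.creOp j a t =
      (∏ i, sgn (S.deg (a i) * S.degH y)) • S.creOp j a (S.hgen y * t) := by
  induction k with
  | zero => simp [creOp]
  | succ k ih =>
    rw [creOp_succ, Module.End.mul_apply, Module.End.mul_apply, hgen_mul_cre, ih, map_smul,
      smul_smul, Fin.prod_univ_succ]

/-- Multiplication by a fixed element lowers the degree by a bounded amount. -/
theorem exists_mul_mem_highDegree (t : S.Tensor) : ∃ m, ∀ n, ∀ s ∈ S.highDegree (n + m),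
    t * s ∈ S.highDegree n ∧ s * t ∈ S.highDegree n := by
  have ht : t ∈ Algebra.adjoin ℂ (Set.range S.osc ∪ Set.range S.hgen) := by
    rw [adjoin_generators]; trivial
  induction ht using Algebra.adjoin_induction with
  | mem t ht =>
    rcases ht with ⟨v, rfl⟩ | ⟨y, rfl⟩
    · refine ⟨1, fun n s hs => ⟨?_, ?_⟩⟩
      · have h1 : S.osc v * s = S.cre v s + (1 / 2 : ℂ) • S.ann v s :=
          LinearMap.congr_fun (S.lop_eq v) s
        rw [h1]
        exact Submodule.add_mem _ (S.highDegree_antitone (by omega) (S.cre_highDegree v hs))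
          (Submodule.smul_mem _ _ (S.ann_highDegree v hs))
      · have h1 : s * S.osc v =
            S.cre v (S.twist v s) + (-1 / 2 : ℂ) • S.ann v (S.twist v s) := by
          refine Eq.trans ?_ (LinearMap.congr_fun (S.rop_eq v) (S.twist v s))
          rw [rop_apply, twist_twist_self]
        have hs' := S.twist_highDegree v hs
        rw [h1]
        exact Submodule.add_mem _ (S.highDegree_antitone (by omega) (S.cre_highDegree v hs'))
          (Submodule.smul_mem _ _ (S.ann_highDegree v hs'))
    · refine ⟨0, fun n s hs => ⟨?_, ?_⟩⟩
      · refine S.map_highDegree (φ := LinearMap.mulLeft ℂ (S.hgen y))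
          (fun k l a b h hkl => ?_) hs
        rw [LinearMap.mulLeft_apply, normalWord, hgen_mul_creOp, hgen_mul_creOp, map_smul,
          smul_smul, hgen, ← map_mul]
        exact Submodule.smul_mem _ _ (S.normalWord_mem _ _ _ hkl)
      · refine S.map_highDegree (φ := LinearMap.mulRight ℂ (S.hgen y))
          (fun k l a b h hkl => ?_) hs
        rw [LinearMap.mulRight_apply, ← normalWord_eq, mul_assoc, hgen, ← map_mul, normalWord_eq]
        exact S.normalWord_mem _ _ _ hkl
  | algebraMap r =>
    refine ⟨0, fun n s hs => ?_⟩
    rw [Algebra.algebraMap_eq_smul_one, smul_mul_assoc, mul_smul_comm, one_mul, mul_one]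
    exact ⟨Submodule.smul_mem _ _ hs, Submodule.smul_mem _ _ hs⟩
  | add x y _ _ hx hy =>
    obtain ⟨m, hm⟩ := hx
    obtain ⟨m', hm'⟩ := hy
    refine ⟨m + m', fun n s hs => ?_⟩
    have h1 := hm n s (S.highDegree_antitone (by omega) hs)
    have h2 := hm' n s (S.highDegree_antitone (by omega) hs)
    rw [add_mul, mul_add]
    exact ⟨Submodule.add_mem _ h1.1 h2.1, Submodule.add_mem _ h1.2 h2.2⟩
  | mul x y _ _ hx hy =>
    obtain ⟨m, hm⟩ := hx
    obtain ⟨m', hm'⟩ := hy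
    refine ⟨m + m', fun n s hs => ⟨?_, ?_⟩⟩
    · rw [mul_assoc]
      exact (hm n _ (hm' (n + m) s (S.highDegree_antitone (by omega) hs)).1).1
    · rw [← mul_assoc]
      exact (hm' n _ (hm (n + m') s (S.highDegree_antitone (by omega) hs)).2).2

theorem divPow_mem_highDegree (k : ℕ) : S.divPow k ∈ S.highDegree (2 * k) := by
  apply Submodule.smul_mem
  induction k with
  | zero =>
    have h := S.normalWord_mem (![] : Fin 0 → ι) (![] : Fin 0 → ι) 1 (n := 2 * 0) le_rfl
    rw [zpow_zero]
    simpa [normalWord, creOp] using h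
  | succ k ih =>
    rw [zpow_succ, zhat, pair, LinearMap.sum_apply]
    refine Submodule.sum_mem _ fun a _ => ?_
    rw [LinearMap.sum_apply]
    refine Submodule.sum_mem _ fun b _ => Submodule.smul_mem _ _ ?_
    exact S.highDegree_antitone (by omega) (S.cre_highDegree (0, a) (S.cre_highDegree (1, b) ih))

/-! ### The spinorial RLL-relation -/

theorem rll_of_recurrence {r : ℕ → ℂ} {u : ℂ} (v : ℂ)
    (hr : ∀ k : ℕ, (k + 2 + u - S.omega) * r (k + 2) = 4 * (u - k) * r k) : S.RLL r u v := by
  intro n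
  have hb : ∃ m, ∀ t ∈ [S.X 0 * S.D 0, S.X 1 * S.D 1, S.X 0 * S.D 1, S.X 1 * S.D 0],
      ∀ s ∈ S.highDegree (n + m), s * t ∈ S.highDegree n ∧ t * s ∈ S.highDegree n := by
    generalize [S.X 0 * S.D 0, S.X 1 * S.D 1, S.X 0 * S.D 1, S.X 1 * S.D 0] = ts
    induction ts with
    | nil => exact ⟨0, by simp⟩
    | cons t ts ih =>
      obtain ⟨m, hm⟩ := ih
      obtain ⟨m', hm'⟩ := S.exists_mul_mem_highDegree t
      refine ⟨m + m', fun t' ht' s hs => ?_⟩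
      rcases List.mem_cons.mp ht' with rfl | ht'
      · exact (hm' n s (S.highDegree_antitone (by omega) hs)).symm
      · exact hm t' ht' s (S.highDegree_antitone (by omega) hs)
  obtain ⟨m, hm⟩ := hb
  -- The boundary terms involve only divided powers beyond `K - 2 ≥ n + m`, so their degree leaves
  -- room for the loss `m`; the extra 2 matches the range of the telescoping sum.
  refine ⟨n + m + 2, fun K hK => ?_⟩
  obtain ⟨K, rfl⟩ : ∃ K', K = K' + 2 := ⟨K - 2, by omega⟩
  have h2 := S.eps_mul_self
  have hR : S.RPartial r (K + 2) =
      ∑ k ∈ Finset.range (K + 2), (r k * (-S.eps) ^ k.choose 2) • S.divPow k := by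
    refine Finset.sum_congr rfl fun k _ => ?_
    have hk : (k.factorial : ℂ) ≠ 0 := by exact_mod_cast k.factorial_ne_zero
    rw [invariant_eq, smul_smul]
    congr 1
    field_simp
  rw [L_eq, L_eq, L_eq, L_eq]
  refine rll_mem (ω := S.omega) (c := fun k => r k * (-S.eps) ^ k.choose 2) h2 S.z_mul_X_zero
    S.z_mul_X_one S.z_mul_D_zero S.z_mul_D_one S.X_mul_X S.D_mul_D S.D_mul_X
    (S.euler_mul_X_mul_D 0) S.z_mul_euler S.divPow_zero S.z_eq_divPow_one S.z_mul_divPow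
    (fun k t ht => S.divPow_comm ht k) (fun k => ?_) (fun t ht k hk => ?_) hR
  -- From `k` to `k + 2` the sign of the invariant changes by `(-ϵ)^(2k+1) = -ϵ`, which turns `4(u -
  -- k)` into `4ϵ(k - u)`.
  · have hc : (k + 2).choose 2 = k.choose 2 + 2 * k + 1 := by
      have h (k : ℕ) : (k + 1).choose 2 = k + k.choose 2 := by
        rw [Nat.choose_succ_succ, Nat.choose_one_right]
      rw [h, h]
      omega
    have hp : (-S.eps) ^ (2 * k) = 1 := by
      rw [pow_mul, neg_sq, sq, h2, one_pow]
    simp only [hc, pow_succ, pow_add, hp]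
    linear_combination (-S.eps * (-S.eps) ^ k.choose 2) * hr k
  · exact hm t ht _ (S.highDegree_antitone (by omega) (S.divPow_mem_highDegree k))

end SuperMetric

/-! ### The super-anticommutator condition -/

theorem sum_perm_fin_three {V : Type*} [AddCommMonoid V] (f : Equiv.Perm (Fin 3) → V) :
    ∑ σ, f σ = f 1 + f (Equiv.swap 0 1) + f (Equiv.swap 1 2) + f (Equiv.swap 0 2) +
      f (Equiv.swap 0 1 * Equiv.swap 1 2) + f (Equiv.swap 1 2 * Equiv.swap 0 1) := by
  have h : (Finset.univ : Finset (Equiv.Perm (Fin 3))) = {1, Equiv.swap 0 1, Equiv.swap 1 2,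
      Equiv.swap 0 2, Equiv.swap 0 1 * Equiv.swap 1 2, Equiv.swap 1 2 * Equiv.swap 0 1} := by
    decide
  rw [h]
  repeat rw [Finset.sum_insert (by decide)]
  rw [Finset.sum_singleton]
  simp only [add_assoc]

theorem superSym_three {ι V : Type*} [AddCommGroup V] [Module ℂ V] (w : ι → ι → ℂ)
    (f : (Fin 3 → ι) → V) (b c d : ι) : superSym w f ![b, c, d] = (6 : ℂ)⁻¹ • (f ![b, c, d] +
      w c b • f ![c, b, d] + w d c • f ![b, d, c] + (w d c * w d b * w c b) • f ![d, c, b] +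
      (w c b * w d b) • f ![c, d, b] + (w d b * w d c) • f ![d, b, c]) := by
  have hf : ∀ σ : Equiv.Perm (Fin 3), (fun i => ![b, c, d] (σ i)) =
      ![![b, c, d] (σ 0), ![b, c, d] (σ 1), ![b, c, d] (σ 2)] := by
    intro σ; funext i; fin_cases i <;> rfl
  have h1 : Equiv.swap (0 : Fin 3) 1 2 = 2 := by decide
  have h2 : Equiv.swap (1 : Fin 3) 2 0 = 0 := by decide
  have h3 : Equiv.swap (0 : Fin 3) 2 1 = 1 := by decide
  unfold superSym
  rw [sum_perm_fin_three]
  simp only [hf]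
  simp [wordSign, Fin.prod_univ_three, h1, h2, h3, Nat.factorial]

namespace SuperMetric

variable {ι : Type*} [Fintype ι] [DecidableEq ι] (S : SuperMetric ι)

section JordanSchwinger

variable {B : Type*} [Ring B] [Algebra ℂ B] {x d : ι → B}

-- Normal ordering reduces everything to quartic terms `x x ∂ ∂` and quadratic terms `g x ∂`. With
-- indices sorted alphabetically, each coefficient becomes a sign identity, checked for both values
-- of `ϵ` and all parities.
set_option maxHeartbeats 4000000 in
theorem jordanSchwinger_cyclic (hx : ∀ a b, x a * x b = S.exch a b • (x b * x a))
    (hd : ∀ a b, d a * d b = S.exch a b • (d b * d a))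
    (hdx : ∀ a b, d a * x b = S.g a b • 1 + S.exch a b • (x b * d a)) {M : ι → ι → B}
    (hM : ∀ a b, M a b = x a * d b - S.exchM a b • (x b * d a)) {f : ι → ι → ι → ι → B}
    (hf : ∀ a b c e, f a b c e = superAnti (S.deg b + S.deg c) (S.deg e + S.deg a) (M b c) (M e a))
    (a b c e : ι) :
    f a b c e + (S.exchM c b * S.exchM e b) • f a c e b + (S.exchM e b * S.exchM e c) • f a e b c
      = 0 := by
  have hn : ∀ a b c e, x a * d b * (x c * d e) =
      S.exch b c • (x a * x c * (d b * d e)) + S.g b c • (x a * d e) := by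
    intro a b c e
    rw [mul_assoc, ← mul_assoc (d b), hdx, add_mul, mul_add, smul_mul_assoc, smul_mul_assoc,
      mul_smul_comm, mul_smul_comm, one_mul]
    simp only [mul_assoc]
    rw [add_comm]
  simp only [hf, superAnti, hM, mul_sub, sub_mul, mul_smul_comm, smul_mul_assoc, hn, hx b a, hx c a,
    hx e a, hx c b, hx e b, hx e c, hd b a, hd c a, hd e a, hd c b, hd e b, hd e c]
  have hz : ∀ a b, S.deg a ≠ S.deg b → S.g a b = 0 := fun a b h => by
    by_contra h'
    exact h (S.deg_eq_of_g h')
  have h11 : (1 + 1 : ZMod 2) = 0 := by decide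
  match_scalars
  all_goals
    try simp only [S.g_swap a b, S.g_swap a c, S.g_swap a e, S.g_swap b c, S.g_swap b e,
      S.g_swap c e]
    simp only [exch, exchM]
    rcases S.eps_eq with h | h <;> rcases S.deg_cases a with ha | ha <;>
      rcases S.deg_cases b with hb | hb <;> rcases S.deg_cases c with hc | hc <;>
      rcases S.deg_cases e with he | he <;>
      simp [h, ha, hb, hc, he, sgn_zero, sgn_one, h11, hz]

theorem exchM_mul_self (a b : ι) : S.exchM a b * S.exchM a b = 1 := by
  have h1 := S.eps_mul_self
  have h2 := sgn_mul_self (S.deg a * S.deg b + S.deg a + S.deg b)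
  unfold exchM
  linear_combination sgn (S.deg a * S.deg b + S.deg a + S.deg b) ^ 2 * h1 + h2

/-- Since M is graded antisymmetric, permutations differing by a swap of the first two letters
contribute equally. The average over six is one third of the cyclic sum. -/
theorem superSym_jordanSchwinger (hx : ∀ a b, x a * x b = S.exch a b • (x b * x a))
    (hd : ∀ a b, d a * d b = S.exch a b • (d b * d a))
    (hdx : ∀ a b, d a * x b = S.g a b • 1 + S.exch a b • (x b * d a)) {M : ι → ι → B}
    (hM : ∀ a b, M a b = x a * d b - S.exchM a b • (x b * d a)) (a b c e : ι) :
    superSym (fun s t => -S.exchM s t) (fun t : Fin 3 → ι =>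
      superAnti (S.deg (t 0) + S.deg (t 1)) (S.deg (t 2) + S.deg a) (M (t 0) (t 1)) (M (t 2) a))
      ![b, c, e] = 0 := by
  obtain ⟨f, hf⟩ : ∃ f : ι → ι → ι → ι → B, ∀ a b c e, f a b c e =
      superAnti (S.deg b + S.deg c) (S.deg e + S.deg a) (M b c) (M e a) := ⟨_, fun _ _ _ _ => rfl⟩
  have hsymm : ∀ b c, M c b = (-S.exchM c b) • M b c := by
    intro b c
    rw [hM, hM, S.exchM_comm b c]
    linear_combination (norm := module) (-S.exchM_mul_self c b) • (x c * d b)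
  have hfs : ∀ b c e, f a c b e = (-S.exchM c b) • f a b c e := by
    intro b c e
    rw [hf, hf, hsymm b c, superAnti, superAnti, add_comm (S.deg c), smul_mul_assoc,
      mul_smul_comm]
    module
  have hcyc := S.jordanSchwinger_cyclic hx hd hdx hM hf a b c e
  rw [superSym_three]
  simp only [Matrix.cons_val_zero, Matrix.cons_val_one, Matrix.cons_val_two, Matrix.head_cons,
    Matrix.tail_cons, ← hf]
  rw [hfs b c e, hfs e b c, hfs c e b, S.exchM_comm b e]
  have h1 := S.exchM_mul_self c b
  have h2 := S.exchM_mul_self e c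
  linear_combination (norm := module) (1 / 3 : ℂ) • hcyc + ((1 / 6 : ℂ) * h1) • f a b c e +
    ((1 / 6 : ℂ) * S.exchM e b * S.exchM c b * h2) • f a c e b

end JordanSchwinger

/-! ### The coefficients given by Gamma functions -/

/-- The functional equation of `1/Γ` holds for every `β`, poles of `Γ` included; only the numerator
needs `α ≠ 0`. -/
theorem gamma_ratio_step (α β : ℂ) (hα : α ≠ 0) :
    β * (Complex.Gamma (α + 1) / Complex.Gamma (β + 1)) =
      α * (Complex.Gamma α / Complex.Gamma β) := by
  rw [Complex.Gamma_add_one α hα, div_eq_mul_inv, div_eq_mul_inv,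
    Complex.one_div_Gamma_eq_self_mul_one_div_Gamma_add_one β]
  ring

theorem gammaCoeff_recurrence (A B : ℂ) {u : ℂ} (hu : ∀ n : ℕ, u ≠ n) (k : ℕ) :
    (k + 2 + u - S.omega) * S.gammaCoeff A B u (k + 2) = 4 * (u - k) * S.gammaCoeff A B u k := by
  have hdiv : (k + 2) / 2 = k / 2 + 1 := by omega
  have hpar : Even (k + 2) ↔ Even k := by simp [Nat.even_add]
  unfold gammaCoeff
  rw [hdiv]
  simp only [hpar]
  split_ifs with h
  · obtain ⟨m, rfl⟩ := h
    have hm : (m + m) / 2 = m := by omega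
    rw [hm]
    -- A zero here would mean `u = 2m`; this is where natural values of `u` are excluded.
    have hα : (m : ℂ) - u / 2 ≠ 0 := by
      intro h0
      apply hu (m + m)
      push_cast
      linear_combination (-2 : ℂ) * h0
    have key := gamma_ratio_step (m - u / 2) (m + 1 + (u - S.omega) / 2) hα
    rw [show ((m + 1 : ℕ) : ℂ) - u / 2 = m - u / 2 + 1 by push_cast; ring,
      show ((m + 1 : ℕ) : ℂ) + 1 + (u - S.omega) / 2 = m + 1 + (u - S.omega) / 2 + 1 by
        push_cast; ring, pow_succ]
    push_cast
    linear_combination (-8 * (-4) ^ m * A) * key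
  · obtain ⟨m, rfl⟩ := Nat.not_even_iff_odd.mp h
    have hm : (2 * m + 1) / 2 = m := by omega
    rw [hm]
    have hα : (m : ℂ) - (u - 1) / 2 ≠ 0 := by
      intro h0
      apply hu (2 * m + 1)
      push_cast
      linear_combination (-2 : ℂ) * h0
    have key := gamma_ratio_step (m - (u - 1) / 2) (m + 1 + (u - S.omega + 1) / 2) hα
    rw [show ((m + 1 : ℕ) : ℂ) - (u - 1) / 2 = m - (u - 1) / 2 + 1 by push_cast; ring,
      show ((m + 1 : ℕ) : ℂ) + 1 + (u - S.omega + 1) / 2 = m + 1 + (u - S.omega + 1) / 2 + 1 by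
        push_cast; ring, pow_succ]
    push_cast
    linear_combination (-8 * (-4) ^ m * B) * key

theorem symAntiM_eq_zero (b c d a : ι) : S.symAntiM b c d a = 0 :=
  S.superSym_jordanSchwinger S.x_mul_x S.d_mul_d S.d_mul_x (fun _ _ => rfl) a b c d

end SuperMetric

end

theorem mainTheorem8 {ι : Type*} [Fintype ι] [DecidableEq ι] (S : SuperMetric ι) :
    -- the super-anticommutator condition on the Jordan-Schwinger generators
    (∀ b c d a : ι, S.symAntiM b c d a = 0) ∧
    -- the RLL-relation with the R-operator given by Gamma functions
    (∀ (A B : ℂ → ℂ) (u v : ℂ), (∀ n : ℕ, u ≠ n) →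
      S.RLL (S.gammaCoeff (A u) (B u) u) u v) ∧
    -- the RLL-relation for every solution of the recurrence, at arbitrary `u`
    (∀ (r : ℕ → ℂ) (u v : ℂ),
      (∀ k : ℕ, (k + 2 + u - S.omega) * r (k + 2) = 4 * (u - k) * r k) →
      S.RLL r u v) :=
  ⟨S.symAntiM_eq_zero, fun A B _ v hu =>
    S.rll_of_recurrence v (S.gammaCoeff_recurrence (A _) (B _) hu),
    fun _ _ v hr => S.rll_of_recurrence v hr⟩
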